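/- Write $\mathfrak R^k$ for the compact sets $\Omega\subset\mathbb R^k$ with $\Omega=\overline{\Omega^\circ}$ whose interior $\Omega^\circ$ is a connected neighbourhood of $0$. Consider $\dot x=g(x,u)$ with $x\in\mathcal X\in\mathfrak R^n$, $u\in\mathcal U\in\mathfrak R^m$, $g(0,0)=0$. Let $\mathcal T=\{\sigma_i\}_{i=1}^{m_{\mathcal T}}$ be a triangulation whose underlying set (also called $\mathcal T$) lies in $\mathfrak R^n$ and is contained in $\mathcal X$: a finite collection of $n$-simplexes $\sigma_i=\mathrm{co}\{x_{i,0},\dots,x_{i,n}\}$, any two of which meet in a common face or not at all, with $x_{i,0}=0$ whenever $0\in\sigma_i$. Let $\mathbb E_{\mathcal T}$ be its set of vertices. A function is in $C^2(\mathcal T)$ if it is continuous on $\mathcal T$ and $C^2$ on each closed simplex $\sigma_i$; second derivatives on $\sigma_i$ are taken within $\sigma_i$. Let $\{u(\cdot,\lambda)\}_{\lambda\in\Lambda}$ be controllers $\mathcal T\to\mathbb R^m$, each Lipschitz and in $C^2(\mathcal T)$, with $u(0,\lambda)=0$. Call $\lambda$ admissible if $u(x,\lambda)\in\mathcal U$ for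 all $x\in\mathbb E_{\mathcal T}$. Assume that some $\lambda$ is admissible, and that for every admissible $\lambda$ we have $u(x,\lambda)\in\mathcal U$ for all $x\in\mathcal T$ and $g_\lambda(x):=g(x,u(x,\lambda))$ is Lipschitz on $\mathcal T$ and in $C^2(\mathcal T)$. For values $\mathbf V=\{V_x\}_{x\in\mathbb E_{\mathcal T}}\subset\mathbb R$ let $V:\mathcal T\to\mathbb R$ be the continuous piecewise affine (CPA) interpolation and $\nabla V_i$ its gradient on $\sigma_i$. Put $c_{i,j}=\frac n2\|x_{i,j}-x_{i,0}\|\big(\max_{1\le k\le n}\|x_{i,k}-x_{i,0}\|+\|x_{i,j}-x_{i,0}\|\big)$. There are numbers $\beta_i=\beta_i(\lambda)$ such that, for every admissible $\lambda$, $$\beta_i\ \ge\ \max_{p,q,r}\ \max_{\xi\in\sigma_i}\Big|\frac{\partial^2 g_\lambda^{(p)}}{\partial x^{(q)}\partial x^{(r)}}(\xi)\Big| ;$$ fix any such numbers, and any real-valued cost $\hat J$. Consider the nonlinear program of minimizing $\hat J(\mathbf V,\mathbf L,\lambda,a,b_1,b_2)$ over $\mathbf V$, $\mathbf L=\{l_i\}\subset\mathbb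 R^n$, $\lambda\in\Lambda$ and $a,b_1,b_2\in\mathbb R$ subject to - $V_0=0$, $a>0$, $b_1>0$; - $b_1\|x\|^a\le V_x$ for all $x\in\mathbb E_{\mathcal T}\setminus\{0\}$; - $|\nabla V_i|\le l_i$ componentwise, for all $i$; - $u(x_{i,j},\lambda)\in\mathcal U$ for all $i,j$; - $g_\lambda(x_{i,j})^\top\nabla V_i+c_{i,j}\beta_i 1_n^\top l_i\le -b_2V_{x_{i,j}}$ for all $i,j$. Then the program is feasible. Further, let $(\mathbf V^*,\mathbf L^*,\lambda^*,a^*,b_1^*,b_2^*)$ be an optimum with $b_2^*>0$. Then: 1. $u(x,\lambda^*)\in\mathcal U$ on $\mathcal T$, and $V^*$ is a Lyapunov function of $\dot x=g_{\lambda^*}(x)$ on $\mathcal T$: it is Lipschitz, $V^*(0)=0$, there are $a',b_1'>0$ with $b_1'\|x\|^{a'}\le V^*(x)$ on $\mathcal T$, and its Dini derivative along $g_{\lambda^*}$ satisfies $D^+V^*(x)\le-b_2^*V^*(x)$ on $\mathcal T^\circ\setminus\{0\}$. If $a^*\ge1$, one can take $a'=a^*$, $b_1'=b_1^*$. 2.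 The origin is locally exponentially stable for $\dot x=g_{\lambda^*}(x)$ on $\mathcal T$. 3. Let $r>0$ be such that $\mathcal A=\{x\in\mathcal T: V^*(x)\in[0,r]\}\in\mathfrak R^n$. If $a^*\ge1$, every solution of $\dot x=g_{\lambda^*}(x)$ in $\mathcal T$ with $x(t_0)\in\mathcal A^\circ$ satisfies $$\|x(t)\|\le (r/b_1^*)^{1/a^*}e^{-(b_2^*/a^*)(t-t_0)}$$ for all $t\ge t_0$ for which it is defined. If moreover (here for any $a^*>0$) $V^*\ge r$ on $\partial\mathcal T$, then for every $x_0\in\mathcal A^\circ$ there is a solution with $x(t_0)=x_0$ that is defined and stays in $\mathcal A^\circ$ for all $t\ge t_0$. -/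

import Mathlib

open Set Filter Topology

noncomputable section

namespace CPAControl

/-- `ℝⁿ` with the Euclidean norm. -/
abbrev E (n : ℕ) : Type := EuclideanSpace ℝ (Fin n)

/-- The class `𝔯ⁿ`: compact sets that are the closure of their interior, the interior being a
connected neighbourhood of the origin. -/
structure IsRegion {n : ℕ} (Ω : Set (E n)) : Prop where
  isCompact : IsCompact Ω
  zero_mem_interior : (0 : E n) ∈ interior Ω
  isConnected_interior : IsConnected (interior Ω)
  eq_closure_interior : Ω = closure (interior Ω)

/-- The closed solid simplex spanned by the `n + 1` vertices of `s`. -/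
def solid {n : ℕ} (s : Affine.Simplex ℝ (E n) n) : Set (E n) :=
  convexHull ℝ (range s.points)

/-- A triangulation: finitely many `n`-simplexes, with ordered vertices `x i 0, …, x i n`,
two of which meet in a common face (the hull of their common vertices) or not at all, whose union
is a region, and such that a simplex containing the origin has it as its vertex number `0`. -/
structure Triangulation (n : ℕ) where
  /-- the number of simplexes -/
  num : ℕ
  /-- the simplexes -/
  simplex : Fin num → Affine.Simplex ℝ (E n) n
  inter_eq : ∀ i k, solid (simplex i) ∩ solid (simplex k) =
    convexHull ℝ (range (simplex i).points ∩ range (simplex k).points)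
  isRegion : IsRegion (⋃ i, solid (simplex i))
  zero_first : ∀ i, (0 : E n) ∈ solid (simplex i) → (simplex i).points 0 = 0

namespace Triangulation

variable {n : ℕ} (T : Triangulation n)

/-- The vertex `x i j`. -/
def x (i : Fin T.num) (j : Fin (n + 1)) : E n := (T.simplex i).points j

/-- The simplex `σ i` as a set of points. -/
def σ (i : Fin T.num) : Set (E n) := solid (T.simplex i)

/-- The set of points covered by the triangulation. -/
def carrier : Set (E n) := ⋃ i, T.σ i

/-- The set of vertices of the triangulation. -/
def vertices : Set (E n) := {v | ∃ i j, T.x i j = v}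

theorem x_mem_vertices (i : Fin T.num) (j : Fin (n + 1)) : T.x i j ∈ T.vertices := ⟨i, j, rfl⟩

theorem zero_mem_vertices : (0 : E n) ∈ T.vertices := by
  obtain ⟨i, hi⟩ := mem_iUnion.1 (interior_subset T.isRegion.zero_mem_interior)
  exact ⟨i, 0, T.zero_first i hi⟩

/-- The vertex `x i j` as an element of the vertex set. -/
def vert (i : Fin T.num) (j : Fin (n + 1)) : T.vertices := ⟨T.x i j, T.x_mem_vertices i j⟩

/-- The origin as an element of the vertex set. -/
def zeroVert : T.vertices := ⟨0, T.zero_mem_vertices⟩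

/-- The matrix whose `j`-th row is `x i j - x i 0`, `j = 1, …, n`. -/
def edgeMatrix (i : Fin T.num) : Matrix (Fin n) (Fin n) ℝ :=
  Matrix.of fun j k => (T.x i j.succ - T.x i 0) k

/-- The gradient on `σ i` of the affine function with the values `W` at the vertices of `σ i`. -/
def grad (W : T.vertices → ℝ) (i : Fin T.num) : E n :=
  WithLp.toLp 2 (Matrix.mulVec (T.edgeMatrix i)⁻¹
    fun j : Fin n => W (T.vert i j.succ) - W (T.vert i 0))

open Classical in
/-- The continuous piecewise affine interpolation of the vertex values `W`
(and `0` outside the triangulation). -/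
def cpa (W : T.vertices → ℝ) (z : E n) : ℝ :=
  if h : ∃ i, z ∈ T.σ i then
    W (T.vert h.choose 0) + inner ℝ (T.grad W h.choose) (z - T.x h.choose 0)
  else 0

theorem isUnit_edgeMatrix (i : Fin T.num) : IsUnit (T.edgeMatrix i) := by
  rw [← Matrix.linearIndependent_rows_iff_isUnit]
  have h := (affineIndependent_iff_linearIndependent_vsub ℝ (T.simplex i).points 0).1
    (T.simplex i).independent
  have h2 := h.comp (fun j : Fin n => (⟨j.succ, Fin.succ_ne_zero j⟩ : {y : Fin (n + 1) // y ≠ 0}))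
    (fun a b hab => by simpa using hab)
  exact h2.map' (WithLp.linearEquiv 2 ℝ (Fin n → ℝ)).toLinearMap
    (LinearMap.ker_eq_bot.2 (LinearEquiv.injective _))

theorem affine_vertex (W : T.vertices → ℝ) (i : Fin T.num) (j : Fin (n + 1)) :
    W (T.vert i 0) + inner ℝ (T.grad W i) (T.x i j - T.x i 0) = W (T.vert i j) := by
  refine Fin.cases ?_ (fun j => ?_) j
  · simp
  · have hdet : IsUnit (T.edgeMatrix i).det :=
      (Matrix.isUnit_iff_isUnit_det _).1 (T.isUnit_edgeMatrix i)
    have h : (T.edgeMatrix i).mulVec (Matrix.mulVec (T.edgeMatrix i)⁻¹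
        fun j : Fin n => W (T.vert i j.succ) - W (T.vert i 0)) j =
        W (T.vert i j.succ) - W (T.vert i 0) := by
      rw [Matrix.mulVec_mulVec, Matrix.mul_nonsing_inv _ hdet, Matrix.one_mulVec]
    have h2 : inner ℝ (T.grad W i) (T.x i j.succ - T.x i 0) =
        W (T.vert i j.succ) - W (T.vert i 0) := by
      rw [← h, PiLp.inner_apply]
      simp [Matrix.mulVec, dotProduct, grad, edgeMatrix]
    rw [h2]; ring

/-- The interpolation is affine on each simplex, with the prescribed gradient. -/
theorem cpa_eq (W : T.vertices → ℝ) (i : Fin T.num) {z : E n} (hz : z ∈ T.σ i) :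
    T.cpa W z = W (T.vert i 0) + inner ℝ (T.grad W i) (z - T.x i 0) := by
  have h : ∃ i, z ∈ T.σ i := ⟨i, hz⟩
  rw [cpa, dif_pos h]
  generalize hk : h.choose = k
  have hzk : z ∈ T.σ k := hk ▸ h.choose_spec
  have hmem : z ∈ convexHull ℝ
      (range (T.simplex i).points ∩ range (T.simplex k).points) := by
    rw [← T.inter_eq]; exact ⟨hz, hzk⟩
  let A : Fin T.num → E n → ℝ := fun i z =>
    W (T.vert i 0) + inner ℝ (T.grad W i) (z - T.x i 0)
  have hconv : Convex ℝ {z | A k z = A i z} := by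
    intro p hp q hq s t _ _ hst
    have key : ∀ i, A i (s • p + t • q) = s * A i p + t * A i q := by
      intro i
      have e : s • p + t • q - T.x i 0 = s • (p - T.x i 0) + t • (q - T.x i 0) := by
        have : T.x i 0 = (s + t) • T.x i 0 := by rw [hst, one_smul]
        nth_rewrite 1 [this]
        module
      simp only [A, e, inner_add_right, inner_smul_right]
      linear_combination (-W (T.vert i 0)) * hst
    change A k _ = A i _
    rw [key, key, show A k p = A i p from hp, show A k q = A i q from hq]
  refine convexHull_min ?_ hconv hmem
  rintro v ⟨⟨j, hj⟩, ⟨j', hj'⟩⟩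
  have h1 := T.affine_vertex W i j
  have h2 := T.affine_vertex W k j'
  have hv : T.vert i j = T.vert k j' := Subtype.ext (hj.trans hj'.symm)
  change A k v = A i v
  have e1 : T.x i j = v := hj
  have e2 : T.x k j' = v := hj'
  rw [e1] at h1
  rw [e2] at h2
  exact h2.trans ((congrArg W hv).symm.trans h1.symm)

/-- The interpolation takes the prescribed values at the vertices. -/
theorem cpa_vert (W : T.vertices → ℝ) (v : T.vertices) : T.cpa W v = W v := by
  obtain ⟨v, i, j, rfl⟩ := v
  have hz : T.x i j ∈ T.σ i := subset_convexHull ℝ _ ⟨j, rfl⟩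
  exact (T.cpa_eq W i hz).trans (T.affine_vertex W i j)

/-- `f ∈ ℂ²(𝒯)`: continuous on the triangulation and `C²` on each closed simplex. -/
def PiecewiseC2 {k : ℕ} (f : E n → E k) : Prop :=
  ContinuousOn f T.carrier ∧ ∀ i, ContDiffOn ℝ 2 f (T.σ i)

/-- `β` bounds the absolute values of all second partial derivatives `∂²f⁽ᵖ⁾/∂x⁽q⁾∂x⁽ʳ⁾` on `σ i`
(taken within `σ i`), for every `i`. -/
def BoundsSecondDerivs (f : E n → E n) (β : Fin T.num → ℝ) : Prop :=
  ∀ i, ∀ ξ ∈ T.σ i, ∀ p q r : Fin n,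
    |(iteratedFDerivWithin ℝ 2 f (T.σ i) ξ
      ![EuclideanSpace.single q (1 : ℝ), EuclideanSpace.single r (1 : ℝ)]) p| ≤ β i

/-- The constant `c i j` (the supremum is the maximum over the vertices other than `x i 0`). -/
def c (i : Fin T.num) (j : Fin (n + 1)) : ℝ :=
  (n : ℝ) / 2 * ‖T.x i j - T.x i 0‖ *
    ((⨆ k : Fin n, ‖T.x i k.succ - T.x i 0‖) + ‖T.x i j - T.x i 0‖)

end Triangulation

/-- The unknowns of the nonlinear program. -/
structure Unknowns {n : ℕ} (T : Triangulation n) (Λ : Type*) where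
  /-- the vertex values -/
  V : T.vertices → ℝ
  /-- the gradient bounds -/
  l : Fin T.num → Fin n → ℝ
  /-- the controller parameter -/
  lam : Λ
  /-- the exponent -/
  a : ℝ
  /-- the coefficient of the lower bound -/
  b₁ : ℝ
  /-- the decay rate -/
  b₂ : ℝ

/-- The closed-loop vector field `x ↦ g(x, u(x, λ))`. -/
def closedLoop {n m : ℕ} {Λ : Type*} (g : E n → E m → E n) (u : E n → Λ → E m) (lam : Λ) :
    E n → E n := fun z => g z (u z lam)

/-- The controller with parameter `lam` takes admissible values at all vertices. -/
def AdmissibleAtVertices {n m : ℕ} {Λ : Type*} (T : Triangulation n) (U : Set (E m))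
    (u : E n → Λ → E m) (lam : Λ) : Prop :=
  ∀ i j, u (T.x i j) lam ∈ U

/-- The constraints of the nonlinear program; `β lam i` is the bound used for the second
derivatives of the closed loop with parameter `lam` on the `i`-th simplex. -/
structure Feasible {n m : ℕ} {Λ : Type*} (T : Triangulation n) (U : Set (E m))
    (g : E n → E m → E n) (u : E n → Λ → E m) (β : Λ → Fin T.num → ℝ)
    (y : Unknowns T Λ) : Prop where
  V_zero : y.V T.zeroVert = 0
  a_pos : 0 < y.a
  b₁_pos : 0 < y.b₁
  lower : ∀ v : T.vertices, (v : E n) ≠ 0 → y.b₁ * ‖(v : E n)‖ ^ y.a ≤ y.V v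
  grad_le : ∀ i k, |T.grad y.V i k| ≤ y.l i k
  input : AdmissibleAtVertices T U u y.lam
  decrease : ∀ i j,
    inner ℝ (closedLoop g u y.lam (T.x i j)) (T.grad y.V i) + T.c i j * β y.lam i * ∑ k, y.l i k
      ≤ -y.b₂ * y.V (T.vert i j)

/-- The Dini derivative `D⁺V(z) = limsup_{h → 0⁺} (V(z + h f(z)) - V(z)) / h` along `f`. -/
def dini {n : ℕ} (f : E n → E n) (V : E n → ℝ) (z : E n) : EReal :=
  limsup (fun h : ℝ => (((V (z + h • f z) - V z) / h : ℝ) : EReal)) (𝓝[>] (0 : ℝ))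

/-- `V` is a Lipschitz Lyapunov function on `Ω` of `ẋ = f(x)`, with constants `a`, `b₁`, `b₂`. -/
structure IsLyapunov {n : ℕ} (f : E n → E n) (Ω : Set (E n)) (V : E n → ℝ) (a b₁ b₂ : ℝ) :
    Prop where
  a_pos : 0 < a
  b₁_pos : 0 < b₁
  b₂_pos : 0 < b₂
  lipschitz : ∃ K, LipschitzOnWith K V Ω
  zero : V 0 = 0
  lower : ∀ z ∈ Ω, b₁ * ‖z‖ ^ a ≤ V z
  decrease : ∀ z ∈ interior Ω \ {0}, dini f V z ≤ ((-b₂ * V z : ℝ) : EReal)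

/-- `x` solves `ẋ = f(x)` in `Ω` on the time set `I` (one-sided derivatives at end points). -/
def IsSolutionOn {n : ℕ} (f : E n → E n) (Ω : Set (E n)) (x : ℝ → E n) (I : Set ℝ) : Prop :=
  ∀ t ∈ I, x t ∈ Ω ∧ HasDerivWithinAt x (f (x t)) I t

/-- The origin is locally exponentially stable for `ẋ = f(x)` in `Ω`: from every initial value
near the origin there is a solution for all future times, and every solution decays. -/
def LocallyExpStable {n : ℕ} (f : E n → E n) (Ω : Set (E n)) : Prop :=
  f 0 = 0 ∧ ∃ δ > 0, ∃ M > 0, ∃ α > 0, ∀ t₀ : ℝ, ∀ x₀ : E n, ‖x₀‖ < δ →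
    (∃ x, IsSolutionOn f Ω x (Ici t₀) ∧ x t₀ = x₀) ∧
    ∀ t₁ x, IsSolutionOn f Ω x (Icc t₀ t₁) → x t₀ = x₀ →
      ∀ t ∈ Icc t₀ t₁, ‖x t‖ ≤ M * ‖x₀‖ * Real.exp (-α * (t - t₀))

end CPAControl

end

open CPAControl

noncomputable section
namespace CPAControl

/-! Let `z` be a convex combination of the vertices of `σ i`, and let `q` be the gradient of `V`
there. By Taylor's formula, replacing `f z` by the same combination of the vertex values of `f`
changes each component by at most the combination of the numbers `c i j * β i`. As `l` dominates
`|q|`, the vertex constraints combine to `⟪f z, q⟫ ≤ -b₂ V z` on every simplex containing `z`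
(`Feasible.inner_grad_le`).

A convex function below the vertex values stays below the interpolation (`le_cpa`), so `V` is at
least a multiple of the norm, and at least `b₁‖z‖ ^ a` if `1 ≤ a`. It is also Lipschitz
(`exists_lipschitzOnWith_cpa`), which needs an argument since the triangulated set need not be
convex.

Near a point only the simplexes containing it matter, so difference quotients of `V` along a
solution reduce to these gradients, and Grönwall gives `V (x t) ≤ V (x t₀) exp (-b₂ (t - t₀))`
(`cpa_solution_le`). With the bounds on `V` this yields the Lyapunov property, local exponential
stability and the explicit estimate. Solutions persist because an open sublevel set off the boundary
cannot be left. Feasibility is cheap: `b₂` may be very negative. -/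

/-- A point of the hull of a subfamily of a finite family is a convex combination with weights
supported on that subfamily. -/
theorem exists_weights_of_mem_convexHull {ι V : Type*} [Fintype ι] [AddCommGroup V] [Module ℝ V]
    (p : ι → V) (S : Set ι) {z : V} (hz : z ∈ convexHull ℝ (p '' S)) :
    ∃ w : ι → ℝ, (∀ i, 0 ≤ w i) ∧ (∀ i ∉ S, w i = 0) ∧ ∑ i, w i = 1 ∧ ∑ i, w i • p i = z := by
  classical
  refine convexHull_min (t := {z | ∃ w : ι → ℝ, (∀ i, 0 ≤ w i) ∧ (∀ i ∉ S, w i = 0) ∧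
    ∑ i, w i = 1 ∧ ∑ i, w i • p i = z}) ?_ ?_ hz
  · rintro _ ⟨i, hi, rfl⟩
    refine ⟨Pi.single i 1, fun j => ?_, fun j hj => ?_, by simp, ?_⟩
    · by_cases h : j = i
      · subst h; simp
      · simp [h]
    · have : j ≠ i := fun h => hj (h ▸ hi)
      simp [this]
    · rw [Finset.sum_eq_single i] <;> simp +contextual
  · rintro _ ⟨w, hw0, hwS, hw1, rfl⟩ _ ⟨w', hw0', hwS', hw1', rfl⟩ a b ha hb hab
    refine ⟨fun i => a * w i + b * w' i, fun i => ?_, fun i hi => ?_, ?_, ?_⟩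
    · have := hw0 i; have := hw0' i; positivity
    · simp [hwS i hi, hwS' i hi]
    · rw [Finset.sum_add_distrib, ← Finset.mul_sum, ← Finset.mul_sum, hw1, hw1']; linarith
    · simp only [add_smul, mul_smul, Finset.sum_add_distrib, Finset.smul_sum]

/-! ### Barycentric weights on simplexes. -/

namespace Triangulation
variable {n : ℕ} (T : Triangulation n)

theorem exists_weights (i : Fin T.num) {z : E n} (hz : z ∈ T.σ i) :
    ∃ w : Fin (n + 1) → ℝ, (∀ j, 0 ≤ w j) ∧ ∑ j, w j = 1 ∧ ∑ j, w j • T.x i j = z := by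
  have hz' : z ∈ convexHull ℝ ((T.simplex i).points '' univ) := by
    rw [image_univ]; exact hz
  obtain ⟨w, h0, -, h1, h2⟩ := exists_weights_of_mem_convexHull _ _ hz'
  exact ⟨w, h0, h1, h2⟩

theorem convex_σ (i : Fin T.num) : Convex ℝ (T.σ i) := convex_convexHull ℝ _

theorem x_mem_σ (i : Fin T.num) (j : Fin (n + 1)) : T.x i j ∈ T.σ i :=
  subset_convexHull ℝ _ ⟨j, rfl⟩

theorem mem_σ_of_weights (i : Fin T.num) {w : Fin (n + 1) → ℝ} (h0 : ∀ j, 0 ≤ w j)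
    (h1 : ∑ j, w j = 1) : ∑ j, w j • T.x i j ∈ T.σ i :=
  (T.convex_σ i).sum_mem (fun j _ => h0 j) h1 fun j _ => T.x_mem_σ i j

theorem cpa_eq_sum (W : T.vertices → ℝ) (i : Fin T.num) {w : Fin (n + 1) → ℝ}
    (h0 : ∀ j, 0 ≤ w j) (h1 : ∑ j, w j = 1) :
    T.cpa W (∑ j, w j • T.x i j) = ∑ j, w j * W (T.vert i j) := by
  rw [T.cpa_eq W i (T.mem_σ_of_weights i h0 h1)]
  have e : ∑ j, w j • T.x i j - T.x i 0 = ∑ j, w j • (T.x i j - T.x i 0) := by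
    simp only [smul_sub, Finset.sum_sub_distrib, ← Finset.sum_smul, h1, one_smul]
  have e2 : W (T.vert i 0) = ∑ j, w j * W (T.vert i 0) := by rw [← Finset.sum_mul, h1, one_mul]
  rw [e, inner_sum, e2, ← Finset.sum_add_distrib]
  refine Finset.sum_congr rfl fun j _ => ?_
  rw [inner_smul_right, ← T.affine_vertex W i j]
  ring

theorem isCompact_σ (i : Fin T.num) : IsCompact (T.σ i) :=
  (finite_range _).isCompact_convexHull ℝ

theorem isClosed_σ (i : Fin T.num) : IsClosed (T.σ i) := (T.isCompact_σ i).isClosed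

theorem isRegion_carrier : IsRegion T.carrier := T.isRegion

theorem zero_mem_carrier : (0 : E n) ∈ T.carrier :=
  interior_subset T.isRegion_carrier.zero_mem_interior

theorem uniqueDiffOn_σ (i : Fin T.num) : UniqueDiffOn ℝ (T.σ i) := by
  refine uniqueDiffOn_convex (T.convex_σ i) ?_
  rw [σ, solid, interior_convexHull_nonempty_iff_affineSpan_eq_top]
  exact (T.simplex i).independent.affineSpan_eq_top_iff_card_eq_finrank_add_one.2 (by simp)

theorem finite_vertices : T.vertices.Finite := by
  refine (finite_range fun q : Fin T.num × Fin (n + 1) => T.x q.1 q.2).subset ?_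
  rintro _ ⟨i, j, rfl⟩
  exact ⟨(i, j), rfl⟩

instance : Finite T.vertices := T.finite_vertices

instance : Fintype T.vertices := Fintype.ofFinite _

theorem vert_injective (i : Fin T.num) : Function.Injective (T.vert i) := fun _ _ h =>
  (T.simplex i).independent.injective (congrArg Subtype.val h)

/-- Near a point, only the simplexes containing that point matter. -/
theorem eventually_mem_σ (z : E n) : ∀ᶠ y in 𝓝 z, ∀ i, y ∈ T.σ i → z ∈ T.σ i := by
  rw [eventually_all]
  intro i
  by_cases h : z ∈ T.σ i
  · exact Eventually.of_forall fun _ _ => h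
  · filter_upwards [(T.isClosed_σ i).isOpen_compl.mem_nhds h] with y hy hy'
    exact absurd hy' hy

theorem sum_vert {M : Type*} [AddCommMonoid M] (i : Fin T.num) (f : T.vertices → M)
    (hf : ∀ v : T.vertices, (v : E n) ∉ range (T.simplex i).points → f v = 0) :
    ∑ j, f (T.vert i j) = ∑ v, f v :=
  Fintype.sum_of_injective _ (T.vert_injective i) _ _
    (fun v hv => hf v fun ⟨j, hj⟩ => hv ⟨j, Subtype.ext hj⟩) fun _ => rfl

/-- Weights on all vertices, supported on a simplex, with vanishing sum and moment are zero. -/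
theorem weights_eq_zero (i : Fin T.num) {d : T.vertices → ℝ}
    (hs : ∀ v : T.vertices, (v : E n) ∉ range (T.simplex i).points → d v = 0)
    (h0 : ∑ v, d v = 0) (h1 : ∑ v, d v • (v : E n) = 0) : d = 0 := by
  have e0 := T.sum_vert i d hs
  have e1 := T.sum_vert i (fun v => d v • (v : E n)) fun v hv => by simp [hs v hv]
  have key := affineIndependent_iff.1 (T.simplex i).independent Finset.univ
    (fun j => d (T.vert i j)) (e0.trans h0) (e1.trans h1)
  funext v
  by_cases hv : (v : E n) ∈ range (T.simplex i).points
  · obtain ⟨j, hj⟩ := hv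
    rw [show v = T.vert i j from Subtype.ext hj.symm]
    exact key j (Finset.mem_univ j)
  · exact hs v hv

/-- Weights on all vertices for a point of the hull of a set of vertices. -/
theorem exists_vertex_weights {S : Set (E n)} (hS : S ⊆ T.vertices) {z : E n}
    (hz : z ∈ convexHull ℝ S) :
    ∃ w : T.vertices → ℝ, (∀ v, 0 ≤ w v) ∧ (∀ v : T.vertices, (v : E n) ∉ S → w v = 0) ∧
      ∑ v, w v = 1 ∧ ∑ v, w v • (v : E n) = z := by
  refine exists_weights_of_mem_convexHull (fun v : T.vertices => (v : E n))
    (Subtype.val ⁻¹' S) ?_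
  rwa [image_preimage_eq_of_subset (by simpa using hS)]

theorem range_subset_vertices (i : Fin T.num) : range (T.simplex i).points ⊆ T.vertices := by
  rintro _ ⟨j, rfl⟩
  exact T.x_mem_vertices i j

theorem cpa_eq_sum_vertices (W : T.vertices → ℝ) (i : Fin T.num) {w : T.vertices → ℝ}
    (h0 : ∀ v, 0 ≤ w v) (hs : ∀ v : T.vertices, (v : E n) ∉ range (T.simplex i).points → w v = 0)
    (h1 : ∑ v, w v = 1) : T.cpa W (∑ v, w v • (v : E n)) = ∑ v, w v * W v := by
  have e0 := T.sum_vert i w hs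
  have e1 := T.sum_vert i (fun v => w v • (v : E n)) fun v hv => by simp [hs v hv]
  have e2 := T.sum_vert i (fun v => w v * W v) fun v hv => by simp [hs v hv]
  rw [← e1, ← e2]
  exact T.cpa_eq_sum W i (fun _ => h0 _) (e0.trans h1)

/-! ### Lipschitz continuity of the interpolation across simplexes. -/

/-- Differences of weights of points of two simplexes. -/
def weightCone (i k : Fin T.num) : Set (T.vertices → ℝ) :=
  {d | ∑ v, d v = 0 ∧ (∀ v : T.vertices, (v : E n) ∉ range (T.simplex k).points → 0 ≤ d v) ∧
    ∀ v : T.vertices, (v : E n) ∉ range (T.simplex i).points → d v ≤ 0}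

theorem isClosed_weightCone (i k : Fin T.num) : IsClosed (T.weightCone i k) := by
  have : T.weightCone i k = {d | ∑ v, d v = 0} ∩
      ((⋂ (v : T.vertices) (_ : (v : E n) ∉ range (T.simplex k).points), {d | 0 ≤ d v}) ∩
        ⋂ (v : T.vertices) (_ : (v : E n) ∉ range (T.simplex i).points), {d | d v ≤ 0}) := by
    ext d
    simp only [weightCone, mem_inter_iff, mem_iInter]
    rfl
  rw [this]
  refine IsClosed.inter (isClosed_eq (by fun_prop) continuous_const) (IsClosed.inter ?_ ?_)
  · exact isClosed_iInter fun v => isClosed_iInter fun _ =>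
      isClosed_le continuous_const (continuous_apply v)
  · exact isClosed_iInter fun v => isClosed_iInter fun _ =>
      isClosed_le (continuous_apply v) continuous_const

/-- The sign conditions put the positive part of `d` on the vertices of `σ i` and the negative part
on those of `σ k`. Both have mass `s` and the same moment, so for `s > 0` they represent one point
of `σ i ∩ σ k`. By `inter_eq` that point also has weights `w` on the common vertices, and uniqueness
of barycentric coordinates in each simplex makes both parts equal to `s * w`. -/
theorem weightCone_eq_zero (i k : Fin T.num) {d : T.vertices → ℝ} (hd : d ∈ T.weightCone i k)
    (h : ∑ v, d v • (v : E n) = 0) : d = 0 := by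
  obtain ⟨hsum, hk, hi⟩ := hd
  have hdec : ∀ v, d v = max (d v) 0 - max (-d v) 0 := fun v => by
    rcases le_total (d v) 0 with h | h
    · rw [max_eq_right h, max_eq_left (by linarith)]; ring
    · rw [max_eq_left h, max_eq_right (by linarith)]; ring
  set s : ℝ := ∑ v, max (d v) 0 with hs
  have hs' : s = ∑ v, max (-d v) 0 := by
    rw [← sub_eq_zero, hs, ← Finset.sum_sub_distrib, Finset.sum_congr rfl fun v _ => (hdec v).symm,
      hsum]
  have hP : ∑ v, max (d v) 0 • (v : E n) = ∑ v, max (-d v) 0 • (v : E n) := by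
    rw [← sub_eq_zero, ← Finset.sum_sub_distrib, ← h]
    refine Finset.sum_congr rfl fun v _ => ?_
    rw [← sub_smul, ← hdec v]
  have hs0 : 0 ≤ s := Finset.sum_nonneg fun v _ => le_max_right _ _
  rcases hs0.eq_or_lt with hz | hpos
  · funext v
    have a1 := (Finset.sum_eq_zero_iff_of_nonneg fun v _ => le_max_right (d v) 0).1 hz.symm v
      (Finset.mem_univ v)
    have a2 := (Finset.sum_eq_zero_iff_of_nonneg fun v _ => le_max_right (-d v) 0).1
      (hs'.symm.trans hz.symm) v (Finset.mem_univ v)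
    rw [hdec v, a1, a2]; simp
  -- the normalized positive and negative parts are weights of the same point
  have mk : ∀ (e : T.vertices → ℝ) (l : Fin T.num), (∀ v, 0 ≤ e v) → ∑ v, e v = s →
      (∀ v : T.vertices, (v : E n) ∉ range (T.simplex l).points → e v = 0) →
      ∃ q ∈ T.σ l, s • q = ∑ v, e v • (v : E n) := by
    intro e l he0 hes hel
    refine ⟨∑ v, (e v / s) • (v : E n), ?_, ?_⟩
    · have e0 := T.sum_vert l (fun v => e v / s) fun v hv => by simp [hel v hv]
      have e1 := T.sum_vert l (fun v => (e v / s) • (v : E n)) fun v hv => by simp [hel v hv]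
      rw [← e1]
      refine T.mem_σ_of_weights l (fun j => div_nonneg (he0 _) hs0) (e0.trans ?_)
      rw [← Finset.sum_div, hes, div_self hpos.ne']
    · simp only [Finset.smul_sum, smul_smul]
      refine Finset.sum_congr rfl fun v _ => ?_
      rw [mul_div_cancel₀ _ hpos.ne']
  have mi := mk (fun v => max (d v) 0) i (fun v => le_max_right _ _) rfl
    fun v hv => max_eq_right (hi v hv)
  have mk' := mk (fun v => max (-d v) 0) k (fun v => le_max_right _ _) hs'.symm
    fun v hv => max_eq_right (by linarith [hk v hv])
  obtain ⟨q, hq, hqe⟩ := mi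
  obtain ⟨q', hq', hqe'⟩ := mk'
  have hqq : q = q' := smul_right_injective _ hpos.ne' (hqe.trans (hP.trans hqe'.symm))
  have hmem : q ∈ convexHull ℝ (range (T.simplex i).points ∩ range (T.simplex k).points) := by
    rw [← T.inter_eq]; exact ⟨hq, hqq ▸ hq'⟩
  obtain ⟨w, -, hwS, hw1, hwq⟩ :=
    T.exists_vertex_weights (inter_subset_left.trans (T.range_subset_vertices i)) hmem
  have z1 : (fun v => max (d v) 0 - s * w v) = 0 := by
    refine T.weights_eq_zero i (fun v hv => ?_) ?_ ?_
    · rw [max_eq_right (hi v hv), hwS v fun h => hv h.1]; ring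
    · rw [Finset.sum_sub_distrib, ← Finset.mul_sum, hw1, ← hs]; ring
    · simp only [sub_smul, mul_smul, Finset.sum_sub_distrib, ← Finset.smul_sum]
      rw [hwq]
      exact sub_eq_zero.2 hqe.symm
  have z2 : (fun v => max (-d v) 0 - s * w v) = 0 := by
    refine T.weights_eq_zero k (fun v hv => ?_) ?_ ?_
    · rw [max_eq_right (by linarith [hk v hv]), hwS v fun h => hv h.2]; ring
    · rw [Finset.sum_sub_distrib, ← Finset.mul_sum, hw1, ← hs']; ring
    · simp only [sub_smul, mul_smul, Finset.sum_sub_distrib, ← Finset.smul_sum]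
      rw [hwq, hqq]
      exact sub_eq_zero.2 hqe'.symm
  funext v
  have y1 := congrFun z1 v
  have y2 := congrFun z2 v
  simp only [Pi.zero_apply] at y1 y2 ⊢
  rw [hdec v]; linarith

/-- The moment does not vanish on the compact unit slice of the closed cone, so its norm has a
positive minimum there; homogeneity does the rest. -/
theorem exists_norm_le_of_mem_weightCone (i k : Fin T.num) :
    ∃ C, 0 ≤ C ∧ ∀ d ∈ T.weightCone i k, ‖d‖ ≤ C * ‖∑ v, d v • (v : E n)‖ := by
  have hcomp : IsCompact (T.weightCone i k ∩ Metric.sphere 0 1) :=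
    (isCompact_sphere _ _).inter_left (T.isClosed_weightCone i k)
  have hcont : Continuous fun d : T.vertices → ℝ => ‖∑ v, d v • (v : E n)‖ := by fun_prop
  obtain ⟨m, hm, hmle⟩ : ∃ m > 0, ∀ d ∈ T.weightCone i k ∩ Metric.sphere 0 1,
      m ≤ ‖∑ v, d v • (v : E n)‖ := by
    rcases (T.weightCone i k ∩ Metric.sphere 0 1).eq_empty_or_nonempty with he | hne
    · exact ⟨1, one_pos, by simp [he]⟩
    · obtain ⟨d, hd, hmin⟩ := hcomp.exists_isMinOn hne hcont.continuousOn
      refine ⟨_, ?_, fun e he => hmin he⟩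
      rw [gt_iff_lt, norm_pos_iff]
      intro h0
      have := T.weightCone_eq_zero i k hd.1 h0
      simpa [this] using hd.2
  refine ⟨m⁻¹, by positivity, fun d hd => ?_⟩
  rcases eq_or_ne d 0 with rfl | hd0
  · simp
  have hn : 0 < ‖d‖ := norm_pos_iff.2 hd0
  have hd' : ‖d‖⁻¹ • d ∈ T.weightCone i k ∩ Metric.sphere 0 1 := by
    refine ⟨⟨?_, fun v hv => ?_, fun v hv => ?_⟩, ?_⟩
    · simp [← Finset.mul_sum, hd.1]
    · exact mul_nonneg (by positivity) (hd.2.1 v hv)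
    · exact mul_nonpos_of_nonneg_of_nonpos (by positivity) (hd.2.2 v hv)
    · simp [norm_smul, hn.ne']
  have := hmle _ hd'
  have e : ∑ v, (‖d‖⁻¹ • d) v • (v : E n) = ‖d‖⁻¹ • ∑ v, d v • (v : E n) := by
    simp [Finset.smul_sum, mul_smul]
  rw [e, norm_smul, norm_inv, norm_norm] at this
  rw [inv_mul_eq_div, le_div_iff₀ hm]
  rw [inv_mul_eq_div, le_div_iff₀ hn] at this
  linarith

/-- The interpolation is Lipschitz on the whole triangulation. -/
theorem exists_lipschitzOnWith_cpa (W : T.vertices → ℝ) :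
    ∃ K, LipschitzOnWith K (T.cpa W) T.carrier := by
  -- For points of any two simplexes, adjacent or not, the distance controls the difference of their
  -- weights, and the weights control the values.
  choose C hC0 hC using T.exists_norm_le_of_mem_weightCone
  have hle : ∀ i k, C i k ≤ ∑ i, ∑ k, C i k := fun i k =>
    (Finset.single_le_sum (fun k _ => hC0 i k) (Finset.mem_univ k)).trans
      (Finset.single_le_sum (f := fun i => ∑ k, C i k)
        (fun i _ => Finset.sum_nonneg fun k _ => hC0 i k) (Finset.mem_univ i))
  have hnn : 0 ≤ (∑ v, |W v|) * ∑ i, ∑ k, C i k :=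
    mul_nonneg (Finset.sum_nonneg fun v _ => abs_nonneg _)
      (Finset.sum_nonneg fun i _ => Finset.sum_nonneg fun k _ => hC0 i k)
  refine ⟨⟨_, hnn⟩, LipschitzOnWith.of_dist_le_mul fun y hy z hz => ?_⟩
  obtain ⟨i, hi⟩ := mem_iUnion.1 hy
  obtain ⟨k, hk⟩ := mem_iUnion.1 hz
  obtain ⟨w, w0, ws, w1, rfl⟩ := T.exists_vertex_weights (T.range_subset_vertices i) hi
  obtain ⟨w', w0', ws', w1', rfl⟩ := T.exists_vertex_weights (T.range_subset_vertices k) hk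
  rw [Real.dist_eq, dist_eq_norm, T.cpa_eq_sum_vertices W i w0 ws w1,
    T.cpa_eq_sum_vertices W k w0' ws' w1', ← Finset.sum_sub_distrib, ← Finset.sum_sub_distrib]
  have hd : (fun v => w v - w' v) ∈ T.weightCone i k := by
    refine ⟨?_, fun v hv => ?_, fun v hv => ?_⟩
    · rw [Finset.sum_sub_distrib, w1, w1', sub_self]
    · simpa [ws' v hv] using w0 v
    · simpa [ws v hv] using w0' v
  have key := hC i k _ hd
  simp only [sub_smul] at key
  calc |∑ v, (w v * W v - w' v * W v)|
      ≤ ∑ v, |W v| * ‖fun v => w v - w' v‖ := by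
        refine (Finset.abs_sum_le_sum_abs _ _).trans (Finset.sum_le_sum fun v _ => ?_)
        rw [← sub_mul, abs_mul, mul_comm]
        exact mul_le_mul_of_nonneg_left (norm_le_pi_norm (fun v => w v - w' v) v) (abs_nonneg _)
    _ ≤ (∑ v, |W v|) * ((∑ i, ∑ k, C i k) * ‖∑ v, (w v • (v : E n) - w' v • (v : E n))‖) := by
        rw [← Finset.sum_mul]
        refine mul_le_mul_of_nonneg_left (key.trans ?_)
          (Finset.sum_nonneg fun v _ => abs_nonneg _)
        exact mul_le_mul_of_nonneg_right (hle i k) (norm_nonneg _)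
    _ = _ := by rw [← mul_assoc]; rfl

/-! ### Lower bounds by convexity. -/

theorem cpa_zero {W : T.vertices → ℝ} (h : W T.zeroVert = 0) : T.cpa W 0 = 0 :=
  (T.cpa_vert W T.zeroVert).trans h

/-- A convex function below the vertex values is below the interpolation. -/
theorem le_cpa {W : T.vertices → ℝ} {φ : E n → ℝ} (hφ : ConvexOn ℝ univ φ)
    (h : ∀ v : T.vertices, φ v ≤ W v) {z : E n} (hz : z ∈ T.carrier) : φ z ≤ T.cpa W z := by
  obtain ⟨i, hi⟩ := mem_iUnion.1 hz
  obtain ⟨w, h0, h1, rfl⟩ := T.exists_weights i hi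
  rw [T.cpa_eq_sum W i h0 h1]
  refine (hφ.map_sum_le (fun j _ => h0 j) h1 fun j _ => mem_univ _).trans ?_
  exact Finset.sum_le_sum fun j _ => mul_le_mul_of_nonneg_left (h (T.vert i j)) (h0 j)

/-- If the vertex values vanish at the origin only and are positive elsewhere, the interpolation
is bounded below by a multiple of the norm. -/
theorem exists_mul_norm_le_cpa {W : T.vertices → ℝ} (h0 : W T.zeroVert = 0)
    (hpos : ∀ v : T.vertices, (v : E n) ≠ 0 → 0 < W v) :
    ∃ c > 0, ∀ z ∈ T.carrier, c * ‖z‖ ≤ T.cpa W z := by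
  obtain ⟨c, hc, hcv⟩ : ∃ c > 0, ∀ v : T.vertices, c * ‖(v : E n)‖ ≤ W v := by
    have hv0 : ∀ v : T.vertices, (v : E n) = 0 → W v = 0 := fun v hv => by
      rw [show v = T.zeroVert from Subtype.ext hv, h0]
    have : ∀ v : T.vertices, ∃ c > 0, ∀ c' ≤ c, c' * ‖(v : E n)‖ ≤ W v := by
      intro v
      by_cases hv : (v : E n) = 0
      · exact ⟨1, one_pos, fun c' _ => by simp [hv, hv0 v hv]⟩
      · have hn : 0 < ‖(v : E n)‖ := norm_pos_iff.2 hv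
        exact ⟨W v / ‖(v : E n)‖, div_pos (hpos v hv) hn, fun c' hc' => (le_div_iff₀ hn).1 hc'⟩
    choose c hc hcle using this
    have : Nonempty T.vertices := ⟨T.zeroVert⟩
    obtain ⟨v, hv⟩ := Finite.exists_min c
    exact ⟨c v, hc v, fun v' => hcle v' _ (hv v')⟩
  refine ⟨c, hc, fun z hz => T.le_cpa (φ := fun z => c * ‖z‖) ?_ hcv hz⟩
  exact convexOn_univ_norm.smul hc.le

/-- The lower bound with an exponent at least one carries over from the vertices. -/
theorem mul_norm_rpow_le_cpa {W : T.vertices → ℝ} (h0 : W T.zeroVert = 0) {a b : ℝ}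
    (ha : 1 ≤ a) (hb : 0 < b) (h : ∀ v : T.vertices, (v : E n) ≠ 0 → b * ‖(v : E n)‖ ^ a ≤ W v)
    {z : E n} (hz : z ∈ T.carrier) : b * ‖z‖ ^ a ≤ T.cpa W z := by
  refine T.le_cpa (φ := fun z => b * ‖z‖ ^ a) ?_ (fun v => ?_) hz
  · refine ConvexOn.smul hb.le (ConvexOn.comp (g := fun s : ℝ => s ^ a) (f := fun z : E n => ‖z‖)
      ?_ convexOn_univ_norm ?_)
    · refine (convexOn_rpow ha).subset ?_ ?_
      · rintro _ ⟨z, -, rfl⟩; exact norm_nonneg z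
      · have := (convexOn_univ_norm (E := E n)).1
        -- The range of the norm is connected, hence an interval.
        exact (isPreconnected_univ.image _ continuous_norm.continuousOn).ordConnected.convex
    · rintro _ ⟨z, -, rfl⟩ _ ⟨z', -, rfl⟩ hzz
      exact Real.rpow_le_rpow (norm_nonneg _) hzz (by linarith)
  · by_cases hv : (v : E n) = 0
    · rw [show v = T.zeroVert from Subtype.ext hv, h0]
      simp [zeroVert, Real.zero_rpow (by linarith : a ≠ 0)]
    · exact h v hv

end Triangulation

/-! ### Taylor estimates and the interpolation error. -/

/-- First-order Taylor estimate on the unit interval. -/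
theorem abs_taylor_le {φ φ' φ'' : ℝ → ℝ} {M : ℝ}
    (h1 : ∀ t ∈ Icc (0 : ℝ) 1, HasDerivWithinAt φ (φ' t) (Icc 0 1) t)
    (h2 : ∀ t ∈ Icc (0 : ℝ) 1, HasDerivWithinAt φ' (φ'' t) (Icc 0 1) t)
    (hM : ∀ t ∈ Icc (0 : ℝ) 1, |φ'' t| ≤ M) : |φ 1 - φ 0 - φ' 0| ≤ M / 2 := by
  have right : ∀ {ψ : ℝ → ℝ} {d t : ℝ}, t ∈ Ico (0 : ℝ) 1 → HasDerivWithinAt ψ d (Icc 0 1) t →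
      HasDerivWithinAt ψ d (Ici t) t := by
    intro ψ d t ht h
    exact h.mono_of_mem_nhdsWithin (Icc_mem_nhdsGE_of_mem ht)
  -- Two comparison estimates take the place of integrating twice, so `φ''` need not be integrable.
  have b1 : ∀ t ∈ Icc (0 : ℝ) 1, ‖φ' t - φ' 0‖ ≤ M * t := by
    refine image_norm_le_of_norm_deriv_right_le_deriv_boundary (f := fun t => φ' t - φ' 0)
      (f' := φ'') (B := fun t => M * t) (B' := fun _ => M) (fun t ht => ?_) (fun t ht => ?_)
      (by simp) (fun t => ?_) (fun t ht => hM t (Ico_subset_Icc_self ht))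
    · exact ((h2 t ht).sub_const _).continuousWithinAt
    · exact right ht ((h2 t (Ico_subset_Icc_self ht)).sub_const _)
    · simpa using (hasDerivAt_id t).const_mul M
  have b2 : ∀ t ∈ Icc (0 : ℝ) 1, ‖φ t - φ 0 - φ' 0 * t‖ ≤ M / 2 * t ^ 2 := by
    have hd : ∀ t ∈ Icc (0 : ℝ) 1,
        HasDerivWithinAt (fun t => φ t - φ 0 - φ' 0 * t) (φ' t - φ' 0) (Icc 0 1) t := by
      intro t ht
      have := ((h1 t ht).sub_const (φ 0)).sub (((hasDerivWithinAt_id t (Icc 0 1)).const_mul (φ' 0)))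
      exact this.congr_deriv (by simp)
    refine image_norm_le_of_norm_deriv_right_le_deriv_boundary
      (f := fun t => φ t - φ 0 - φ' 0 * t)
      (f' := fun t => φ' t - φ' 0) (B := fun t => M / 2 * t ^ 2) (B' := fun t => M * t)
      (fun t ht => (hd t ht).continuousWithinAt)
      (fun t ht => right ht (hd t (Ico_subset_Icc_self ht)))
      (by simp) (fun t => ?_) (fun t ht => b1 t (Ico_subset_Icc_self ht))
    have := (hasDerivAt_pow 2 t).const_mul (M / 2)
    exact this.congr_deriv (by norm_num; ring)
  simpa using b2 1 (by simp)

/-- A bilinear form with coefficients bounded by `b` is bounded by `n b ‖v‖²`. -/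
theorem abs_bilin_apply_le {n : ℕ} (B : E n →L[ℝ] E n →L[ℝ] ℝ) {b : ℝ}
    (hb : ∀ q r, |B (EuclideanSpace.single q 1) (EuclideanSpace.single r 1)| ≤ b) (v : E n) :
    |B v v| ≤ b * n * ‖v‖ ^ 2 := by
  rcases Nat.eq_zero_or_pos n with rfl | hn
  · have : v = 0 := Subsingleton.elim _ _
    simp [this]
  have hb0 : 0 ≤ b := (abs_nonneg _).trans (hb ⟨0, hn⟩ ⟨0, hn⟩)
  have hv : v = ∑ q, v q • EuclideanSpace.single q (1 : ℝ) := by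
    ext k
    simp [Pi.single_apply]
  have e : B v v = ∑ q, ∑ r, v q * (v r *
      B (EuclideanSpace.single q 1) (EuclideanSpace.single r 1)) := by
    conv_lhs => rw [hv]
    simp only [map_sum, map_smul, sum_apply, smul_apply,
      smul_eq_mul, Finset.mul_sum]
    rw [Finset.sum_comm]
    refine Finset.sum_congr rfl fun q _ => Finset.sum_congr rfl fun r _ => by ring
  -- Cauchy–Schwarz; this is the source of the factor `n` in `c i j`.
  have hs : (∑ q, |v q|) ^ 2 ≤ n * ‖v‖ ^ 2 := by
    have := sq_sum_le_card_mul_sum_sq (s := Finset.univ) (f := fun q => |v q|)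
    simpa [EuclideanSpace.real_norm_sq_eq] using this
  calc |B v v| ≤ ∑ q, ∑ r, |v q| * (|v r| * b) := by
        rw [e]
        refine (Finset.abs_sum_le_sum_abs _ _).trans (Finset.sum_le_sum fun q _ =>
          (Finset.abs_sum_le_sum_abs _ _).trans (Finset.sum_le_sum fun r _ => ?_))
        rw [abs_mul, abs_mul]
        gcongr
        exact hb q r
    _ = b * (∑ q, |v q|) ^ 2 := by
        rw [sq, Finset.sum_mul_sum, Finset.mul_sum]
        refine Finset.sum_congr rfl fun q _ => ?_
        rw [Finset.mul_sum]
        exact Finset.sum_congr rfl fun r _ => by ring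
    _ ≤ b * (n * ‖v‖ ^ 2) := mul_le_mul_of_nonneg_left hs hb0
    _ = _ := by ring

/-- Taylor estimate on a convex set for the components of a `C²` map. -/
theorem abs_sub_fderivWithin_le {n : ℕ} {s : Set (E n)} (hs : Convex ℝ s)
    (hu : UniqueDiffOn ℝ s) {f : E n → E n} (hf : ContDiffOn ℝ 2 f s) {b : ℝ} (p : Fin n)
    (hb : ∀ ξ ∈ s, ∀ q r : Fin n, |(iteratedFDerivWithin ℝ 2 f s ξ
      ![EuclideanSpace.single q (1 : ℝ), EuclideanSpace.single r (1 : ℝ)]) p| ≤ b)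
    {y z : E n} (hy : y ∈ s) (hz : z ∈ s) :
    |f z p - f y p - fderivWithin ℝ f s y (z - y) p| ≤ b * n * ‖z - y‖ ^ 2 / 2 := by
  have hline : ∀ t ∈ Icc (0 : ℝ) 1, y + t • (z - y) ∈ s := fun t ht =>
    hs.add_smul_sub_mem hy hz ht
  have hd : ∀ t, HasDerivWithinAt (fun t : ℝ => y + t • (z - y)) (z - y) (Icc 0 1) t := fun t => by
    simpa using ((hasDerivWithinAt_id t (Icc 0 1)).smul_const (z - y)).const_add y
  have hf1 : ∀ ξ ∈ s, HasFDerivWithinAt f (fderivWithin ℝ f s ξ) s ξ := fun ξ hξ =>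
    (hf.differentiableOn (by norm_num) ξ hξ).hasFDerivWithinAt
  have hf2 : ∀ ξ ∈ s, HasFDerivWithinAt (fderivWithin ℝ f s)
      (fderivWithin ℝ (fderivWithin ℝ f s) s ξ) s ξ := fun ξ hξ =>
    ((hf.fderivWithin hu (m := 1) (by norm_num)).differentiableOn (by norm_num)
      ξ hξ).hasFDerivWithinAt
  let π : E n →L[ℝ] ℝ := EuclideanSpace.proj p
  -- The `p`-th component is restricted to the segment from `y` to `z`, where its second derivative
  -- is the Hessian evaluated at `(z - y, z - y)`.
  have key := abs_taylor_le (φ := fun t => π (f (y + t • (z - y))))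
    (φ' := fun t => π (fderivWithin ℝ f s (y + t • (z - y)) (z - y)))
    (φ'' := fun t => π (fderivWithin ℝ (fderivWithin ℝ f s) s (y + t • (z - y)) (z - y) (z - y)))
    (M := b * n * ‖z - y‖ ^ 2)
    (fun t ht => ?_) (fun t ht => ?_) (fun t ht => ?_)
  · simpa [π] using key
  · exact π.hasFDerivAt.comp_hasDerivWithinAt t
      ((hf1 _ (hline t ht)).comp_hasDerivWithinAt t (hd t) hline)
  · have h := (hf2 _ (hline t ht)).comp_hasDerivWithinAt t (hd t) hline
    exact (π.comp (ContinuousLinearMap.apply ℝ (E n) (z - y))).hasFDerivAt.comp_hasDerivWithinAt t h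
  · let B : E n →L[ℝ] E n →L[ℝ] ℝ := (ContinuousLinearMap.compL ℝ (E n) (E n) ℝ π).comp
      (fderivWithin ℝ (fderivWithin ℝ f s) s (y + t • (z - y)))
    refine abs_bilin_apply_le B (fun q r => ?_) (z - y)
    have := hb _ (hline t ht) q r
    rwa [iteratedFDerivWithin_two_apply' _ hu (hline t ht)] at this

namespace Triangulation
variable {n : ℕ} (T : Triangulation n)

/-- Second derivatives of a piecewise `C²` map are bounded. -/
theorem exists_boundsSecondDerivs {f : E n → E n} (hf : T.PiecewiseC2 f) :
    ∃ β, T.BoundsSecondDerivs f β := by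
  have : ∀ i, ∃ b, ∀ ξ ∈ T.σ i, ‖iteratedFDerivWithin ℝ 2 f (T.σ i) ξ‖ ≤ b := fun i =>
    (T.isCompact_σ i).exists_bound_of_continuousOn
      ((hf.2 i).continuousOn_iteratedFDerivWithin le_rfl (T.uniqueDiffOn_σ i))
  choose b hb using this
  refine ⟨b, fun i ξ hξ p q r => ?_⟩
  have h := ContinuousMultilinearMap.le_opNorm (iteratedFDerivWithin ℝ 2 f (T.σ i) ξ)
    ![EuclideanSpace.single q (1 : ℝ), EuclideanSpace.single r (1 : ℝ)]
  have hp : ∏ k : Fin 2, ‖(![EuclideanSpace.single q (1 : ℝ), EuclideanSpace.single r (1 : ℝ)] :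
      Fin 2 → E n) k‖ = 1 := by simp [Fin.prod_univ_two]
  rw [hp, mul_one] at h
  exact (PiLp.norm_apply_le _ p).trans (h.trans (hb i ξ hξ))

/-- One factor of the square is bounded by convexity of the norm, the other by the longest edge at
`x i 0`. The remainder at an arbitrary point thus becomes a combination of vertex terms. -/
theorem norm_sub_le_iSup (i : Fin T.num) {w : Fin (n + 1) → ℝ} (h0 : ∀ j, 0 ≤ w j)
    (h1 : ∑ j, w j = 1) :
    ‖∑ j, w j • T.x i j - T.x i 0‖ ^ 2 ≤
      ∑ j, w j * (‖T.x i j - T.x i 0‖ * ⨆ k : Fin n, ‖T.x i k.succ - T.x i 0‖) := by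
  have e : ∑ j, w j • T.x i j - T.x i 0 = ∑ j, w j • (T.x i j - T.x i 0) := by
    simp only [smul_sub, Finset.sum_sub_distrib, ← Finset.sum_smul, h1, one_smul]
  have hle : ∀ j, ‖T.x i j - T.x i 0‖ ≤ ⨆ k : Fin n, ‖T.x i k.succ - T.x i 0‖ := by
    refine Fin.cases ?_ fun k => ?_
    · simp only [sub_self, norm_zero]
      exact Real.iSup_nonneg fun k => norm_nonneg _
    · exact le_ciSup (f := fun k : Fin n => ‖T.x i k.succ - T.x i 0‖) (finite_range _).bddAbove k
  have hn : ‖∑ j, w j • T.x i j - T.x i 0‖ ≤ ∑ j, w j * ‖T.x i j - T.x i 0‖ := by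
    rw [e]
    refine (norm_sum_le _ _).trans (Finset.sum_le_sum fun j _ => ?_)
    rw [norm_smul, Real.norm_of_nonneg (h0 j)]
  have hS : ‖∑ j, w j • T.x i j - T.x i 0‖ ≤ ⨆ k : Fin n, ‖T.x i k.succ - T.x i 0‖ := by
    refine hn.trans ((Finset.sum_le_sum fun j _ =>
      mul_le_mul_of_nonneg_left (hle j) (h0 j)).trans ?_)
    rw [← Finset.sum_mul, h1, one_mul]
  rw [sq]
  refine (mul_le_mul hn hS (norm_nonneg _)
    (Finset.sum_nonneg fun j _ => mul_nonneg (h0 j) (norm_nonneg _))).trans ?_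
  rw [Finset.sum_mul]
  exact Finset.sum_le_sum fun j _ => by rw [mul_assoc]

/-- The error of linear interpolation of a piecewise `C²` map on a simplex. -/
theorem abs_interpolation_error_le {f : E n → E n} (hf : T.PiecewiseC2 f) {β : Fin T.num → ℝ}
    (hβ : T.BoundsSecondDerivs f β) (i : Fin T.num) {w : Fin (n + 1) → ℝ} (h0 : ∀ j, 0 ≤ w j)
    (h1 : ∑ j, w j = 1) (p : Fin n) :
    |f (∑ j, w j • T.x i j) p - ∑ j, w j * f (T.x i j) p| ≤ ∑ j, w j * (T.c i j * β i) := by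
  have hβ0 : 0 ≤ β i := (abs_nonneg _).trans (hβ i _ (T.x_mem_σ i 0) p p p)
  set D := fderivWithin ℝ f (T.σ i) (T.x i 0)
  -- Interpolation reproduces affine maps, so only the Taylor remainder `R` at `x i 0` contributes
  -- to the error. Its value at the point gives the maximum in `c i j`, its values at the vertices
  -- give the other summand.
  set R : E n → ℝ := fun z => f z p - f (T.x i 0) p - D (z - T.x i 0) p with hR
  have hRle : ∀ z ∈ T.σ i, |R z| ≤ β i * n * ‖z - T.x i 0‖ ^ 2 / 2 := fun z hz =>
    abs_sub_fderivWithin_le (T.convex_σ i) (T.uniqueDiffOn_σ i) (hf.2 i) p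
      (fun ξ hξ q r => hβ i ξ hξ p q r) (T.x_mem_σ i 0) hz
  have e : ∑ j, w j • T.x i j - T.x i 0 = ∑ j, w j • (T.x i j - T.x i 0) := by
    simp only [smul_sub, Finset.sum_sub_distrib, ← Finset.sum_smul, h1, one_smul]
  have hsplit : f (∑ j, w j • T.x i j) p - ∑ j, w j * f (T.x i j) p =
      R (∑ j, w j • T.x i j) - ∑ j, w j * R (T.x i j) := by
    have eD : D (∑ j, w j • T.x i j - T.x i 0) p = ∑ j, w j * D (T.x i j - T.x i 0) p := by
      rw [e]; simp
    simp only [hR]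
    rw [eD]
    simp only [mul_sub, Finset.sum_sub_distrib, ← Finset.sum_mul, h1, one_mul]
    ring
  rw [hsplit]
  have hz := hRle _ (T.mem_σ_of_weights i h0 h1)
  have hsq := T.norm_sub_le_iSup i h0 h1
  have hsum : |∑ j, w j * R (T.x i j)| ≤
      ∑ j, w j * (β i * n * ‖T.x i j - T.x i 0‖ ^ 2 / 2) := by
    refine (Finset.abs_sum_le_sum_abs _ _).trans (Finset.sum_le_sum fun j _ => ?_)
    rw [abs_mul, abs_of_nonneg (h0 j)]
    exact mul_le_mul_of_nonneg_left (hRle _ (T.x_mem_σ i j)) (h0 j)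
  have hcoef : 0 ≤ β i * n / 2 := by positivity
  calc |R (∑ j, w j • T.x i j) - ∑ j, w j * R (T.x i j)|
      ≤ |R (∑ j, w j • T.x i j)| + |∑ j, w j * R (T.x i j)| := abs_sub _ _
    _ ≤ β i * n / 2 * (∑ j, w j * (‖T.x i j - T.x i 0‖ *
          ⨆ k : Fin n, ‖T.x i k.succ - T.x i 0‖)) +
        ∑ j, w j * (β i * n * ‖T.x i j - T.x i 0‖ ^ 2 / 2) := by
        refine add_le_add (hz.trans ?_) hsum
        have := mul_le_mul_of_nonneg_left hsq hcoef
        linarith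
    _ = ∑ j, w j * (T.c i j * β i) := by
        rw [Finset.mul_sum, ← Finset.sum_add_distrib]
        refine Finset.sum_congr rfl fun j _ => ?_
        rw [c]
        ring

end Triangulation

/-! ### The decrease condition on simplexes, and feasibility. -/

section
variable {n m : ℕ} {Λ : Type*} {T : Triangulation n} {U : Set (E m)} {g : E n → E m → E n}
  {u : E n → Λ → E m} {β : Λ → Fin T.num → ℝ}

/-- The decrease condition holds on the whole simplex. -/
theorem Feasible.inner_grad_le {y : Unknowns T Λ} (hy : Feasible T U g u β y)
    (hf : T.PiecewiseC2 (closedLoop g u y.lam))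
    (hβ : T.BoundsSecondDerivs (closedLoop g u y.lam) (β y.lam)) (i : Fin T.num) {z : E n}
    (hz : z ∈ T.σ i) :
    inner ℝ (closedLoop g u y.lam z) (T.grad y.V i) ≤ -y.b₂ * T.cpa y.V z := by
  obtain ⟨w, h0, h1, rfl⟩ := T.exists_weights i hz
  rw [T.cpa_eq_sum y.V i h0 h1]
  have hdec := hy.decrease i
  have hl := hy.grad_le i
  have herr := T.abs_interpolation_error_le hf hβ i h0 h1
  generalize closedLoop g u y.lam = f at *
  generalize T.grad y.V i = q at *
  set S := ∑ j, w j * (T.c i j * β y.lam i)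
  have hin : ∀ a : E n, inner ℝ a q = ∑ p, a p * q p := fun a => by
    simp [PiLp.inner_apply, mul_comm]
  -- The first sum is the interpolation error of `f` paired with `q`; the term `c β ∑ l` of the
  -- constraint exists to absorb it.
  have hsplit : inner ℝ (f (∑ j, w j • T.x i j)) q =
      ∑ p, (f (∑ j, w j • T.x i j) p - ∑ j, w j * f (T.x i j) p) * q p +
        ∑ j, w j * inner ℝ (f (T.x i j)) q := by
    simp only [hin, sub_mul, Finset.sum_sub_distrib, Finset.sum_mul, Finset.mul_sum]
    rw [Finset.sum_comm (f := fun p j => w j * f (T.x i j) p * q p)]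
    simp only [mul_assoc, sub_add_cancel]
  have h3 : ∑ p, (f (∑ j, w j • T.x i j) p - ∑ j, w j * f (T.x i j) p) * q p ≤
      ∑ p, S * y.l i p := by
    refine Finset.sum_le_sum fun p _ => (le_abs_self _).trans ?_
    rw [abs_mul]
    exact mul_le_mul (herr p) (hl p) (abs_nonneg _) ((abs_nonneg _).trans (herr p))
  calc inner ℝ (f (∑ j, w j • T.x i j)) q
      ≤ ∑ p, S * y.l i p + ∑ j, w j * inner ℝ (f (T.x i j)) q := by
        rw [hsplit]; exact add_le_add_left h3 _
    _ = ∑ j, w j * (inner ℝ (f (T.x i j)) q + T.c i j * β y.lam i * ∑ k, y.l i k) := by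
        rw [← Finset.mul_sum, Finset.sum_mul, ← Finset.sum_add_distrib]
        exact Finset.sum_congr rfl fun j _ => by ring
    _ ≤ ∑ j, w j * (-y.b₂ * y.V (T.vert i j)) :=
        Finset.sum_le_sum fun j _ => mul_le_mul_of_nonneg_left (hdec j) (h0 j)
    _ = _ := by
        rw [Finset.mul_sum]
        exact Finset.sum_congr rfl fun j _ => by ring

/-- With the norm as vertex values, a sufficiently negative `b₂` settles every vertex except the
origin. There both sides vanish: the closed loop is zero, and the origin is vertex `0` of its
simplex, so `c i 0 = 0`. -/
theorem exists_feasible (hg : g 0 0 = 0) (hu_zero : ∀ lam, u 0 lam = 0)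
    (hu_ex : ∃ lam, AdmissibleAtVertices T U u lam) (β : Λ → Fin T.num → ℝ) :
    ∃ y, Feasible T U g u β y := by
  obtain ⟨lam, hlam⟩ := hu_ex
  let V : T.vertices → ℝ := fun v => ‖(v : E n)‖
  let S : Fin T.num → Fin (n + 1) → ℝ := fun i j =>
    inner ℝ (closedLoop g u lam (T.x i j)) (T.grad V i) +
      T.c i j * β lam i * ∑ k, |T.grad V i k|
  have hnn : ∀ i j, 0 ≤ |S i j| / ‖T.x i j‖ := fun i j => by positivity
  refine ⟨⟨V, fun i k => |T.grad V i k|, lam, 1, 1, -∑ i, ∑ j, |S i j| / ‖T.x i j‖⟩,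
    norm_zero, one_pos, one_pos, fun v _ => by simp [V], fun i k => le_rfl, hlam, fun i j => ?_⟩
  change S i j ≤ -(-∑ i, ∑ j, |S i j| / ‖T.x i j‖) * ‖T.x i j‖
  rw [neg_neg]
  by_cases hx : T.x i j = 0
  · have hj : j = 0 := (T.simplex i).independent.injective
      (hx.trans (T.zero_first i (hx ▸ T.x_mem_σ i j)).symm)
    subst hj
    simp [S, hx, closedLoop, hu_zero, hg, Triangulation.c]
  · have hn : 0 < ‖T.x i j‖ := norm_pos_iff.2 hx
    rw [← div_le_iff₀ hn]
    calc S i j / ‖T.x i j‖ ≤ |S i j| / ‖T.x i j‖ := by gcongr; exact le_abs_self _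
      _ ≤ ∑ j, |S i j| / ‖T.x i j‖ :=
        Finset.single_le_sum (fun j _ => hnn i j) (Finset.mem_univ j)
      _ ≤ _ := Finset.single_le_sum (f := fun i => ∑ j, |S i j| / ‖T.x i j‖)
        (fun i _ => Finset.sum_nonneg fun j _ => hnn i j) (Finset.mem_univ i)
end

/-! ### Global existence for ordinary differential equations. -/

/-- A bounded Lipschitz vector field has solutions for all future times. -/
theorem exists_forall_hasDerivWithinAt_Ici {V : Type*} [NormedAddCommGroup V] [NormedSpace ℝ V]
    [CompleteSpace V] {f : V → V} {K L : NNReal} (hf : LipschitzWith K f) (hL : ∀ z, ‖f z‖ ≤ L)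
    (t₀ : ℝ) (x₀ : V) :
    ∃ x : ℝ → V, x t₀ = x₀ ∧ ∀ t ∈ Ici t₀, HasDerivWithinAt x (f (x t)) (Ici t₀) t := by
  -- Speed at most `L` keeps the solution within `L * N` of `x₀`, so Picard–Lindelöf applies on an
  -- interval of any length `N`.
  have hloc : ∀ N : ℕ, ∃ x : ℝ → V, x t₀ = x₀ ∧
      ∀ t ∈ Icc t₀ (t₀ + N), HasDerivWithinAt x (f (x t)) (Icc t₀ (t₀ + N)) t := by
    intro N
    have hP : IsPicardLindelof (fun _ => f) (tmin := t₀) (tmax := t₀ + N)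
        ⟨t₀, le_rfl, by simp⟩ x₀ (L * N) 0 L K :=
      IsPicardLindelof.of_time_independent (fun z _ => hL z) hf.lipschitzOnWith (by simp)
    exact hP.exists_eq_forall_mem_Icc_hasDerivWithinAt₀
  choose α hα0 hα using hloc
  have huniq : ∀ M N : ℕ, ∀ s ∈ Icc t₀ (t₀ + M), s ∈ Icc t₀ (t₀ + N) → α M s = α N s := by
    intro M N s hM hN
    have aux : ∀ N : ℕ, s ∈ Icc t₀ (t₀ + N) → ContinuousOn (α N) (Icc t₀ s) ∧
        ∀ t ∈ Ico t₀ s, HasDerivWithinAt (α N) (f (α N t)) (Ici t) t := by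
      intro N hN
      refine ⟨fun t ht => ?_, fun t ht => ?_⟩
      · exact ((hα N t ⟨ht.1, ht.2.trans hN.2⟩).mono
          (Icc_subset_Icc_right hN.2)).continuousWithinAt
      · exact (hα N t ⟨ht.1, ht.2.le.trans hN.2⟩).mono_of_mem_nhdsWithin
          (Icc_mem_nhdsGE_of_mem ⟨ht.1, ht.2.trans_le hN.2⟩)
    exact ODE_solution_unique (v := fun _ => f) (fun _ => hf) (aux M hM).1 (aux M hM).2
      (aux N hN).1 (aux N hN).2 ((hα0 M).trans (hα0 N).symm) ⟨hM.1, le_rfl⟩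
  have hceil : ∀ t ≥ t₀, t ∈ Icc t₀ (t₀ + (⌈t - t₀⌉₊ + 1 : ℕ)) := fun t ht => by
    refine ⟨ht, ?_⟩
    have := Nat.le_ceil (t - t₀)
    push_cast
    linarith
  -- The `+ 1` puts `t` strictly before the end of its interval, so a single `α N` describes the
  -- glued curve near `t`.
  refine ⟨fun t => α (⌈t - t₀⌉₊ + 1) t, hα0 _, fun t ht => ?_⟩
  set N := ⌈t - t₀⌉₊ + 1 with hN
  have hlt : t < t₀ + N := by
    have := Nat.le_ceil (t - t₀)
    rw [hN]
    push_cast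
    linarith
  have hnh : Icc t₀ (t₀ + N) ∈ 𝓝[Ici t₀] t := by
    filter_upwards [self_mem_nhdsWithin, mem_nhdsWithin_of_mem_nhds (Iio_mem_nhds hlt)]
      with s hs hs'
    exact ⟨hs, hs'.le⟩
  refine ((hα N t (hceil t ht)).mono_of_mem_nhdsWithin hnh).congr_of_eventuallyEq ?_ rfl
  filter_upwards [hnh] with s hs
  exact huniq _ _ s (hceil s hs.1) hs

/-- A Lipschitz map on a compact set extends to a bounded Lipschitz map. -/
theorem exists_bounded_lipschitz_extension {n : ℕ} {s : Set (E n)} (hs : IsCompact s)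
    {f : E n → E n} {K : NNReal} (hf : LipschitzOnWith K f s) :
    ∃ (g : E n → E n) (K' L : NNReal), LipschitzWith K' g ∧ (∀ z, ‖g z‖ ≤ L) ∧ EqOn f g s := by
  obtain ⟨f', hf', heq⟩ := hf.extend_finite_dimension
  obtain ⟨R, hR⟩ := hs.exists_bound_of_continuousOn hf.continuousOn
  -- Clamping coordinates to `[-R, R]` leaves `f` unchanged on `s`. If `s` is empty, `R` may be
  -- negative, hence `|R|` in the bound.
  let cl : ℝ → ℝ := fun a => max (-R) (min R a)
  have hcl : LipschitzWith 1 cl := (LipschitzWith.id.const_min R).const_max (-R)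
  have hclR : ∀ a, ‖cl a‖ ≤ |R| := fun a => by
    rw [Real.norm_eq_abs, abs_le]
    refine ⟨(neg_le_neg (le_abs_self R)).trans (le_max_left _ _), max_le (neg_le_abs R) ?_⟩
    exact (min_le_left _ _).trans (le_abs_self R)
  have hcl_eq : ∀ a, |a| ≤ R → cl a = a := fun a ha => by
    rw [abs_le] at ha
    simp only [cl]
    rw [min_eq_right ha.2, max_eq_right ha.1]
  let c : (Fin n → ℝ) → Fin n → ℝ := fun v i => cl (v i)
  have hc : LipschitzWith 1 c := LipschitzWith.of_dist_le_mul fun v w => by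
    rw [NNReal.coe_one, one_mul, dist_pi_le_iff dist_nonneg]
    intro i
    exact (hcl.dist_le_mul _ _).trans (by simpa using dist_le_pi_dist v w i)
  obtain ⟨C, h1⟩ : ∃ C, LipschitzWith C (WithLp.toLp 2 : (Fin n → ℝ) → E n) :=
    ⟨_, PiLp.lipschitzWith_toLp 2 (fun _ : Fin n => ℝ)⟩
  have h2 := PiLp.lipschitzWith_ofLp 2 (fun _ : Fin n => ℝ)
  refine ⟨fun z => WithLp.toLp 2 (c (WithLp.ofLp (f' z))), _, C * ‖R‖₊,
    h1.comp (hc.comp (h2.comp hf')), fun z => ?_, fun z hz => ?_⟩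
  · have := h1.dist_le_mul (c (WithLp.ofLp (f' z))) 0
    rw [WithLp.toLp_zero, dist_zero_right, dist_zero_right] at this
    refine this.trans ?_
    rw [NNReal.coe_mul]
    refine mul_le_mul_of_nonneg_left ?_ (NNReal.coe_nonneg _)
    rw [pi_norm_le_iff_of_nonneg (NNReal.coe_nonneg _)]
    exact fun i => hclR _
  · ext i
    have : |f z i| ≤ R := (PiLp.norm_apply_le (f z) i).trans (hR z hz)
    simp only [c]
    rw [← heq hz, hcl_eq _ this]

/-! ### Decay along the flow, invariance and stability. -/

namespace Triangulation
variable {n : ℕ} {T : Triangulation n} {W : T.vertices → ℝ} {f : E n → E n} {b : ℝ}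

theorem cpa_sub_cpa (T : Triangulation n) (W : T.vertices → ℝ) {i : Fin T.num} {y z : E n}
    (hy : y ∈ T.σ i) (hz : z ∈ T.σ i) :
    T.cpa W y - T.cpa W z = inner ℝ (T.grad W i) (y - z) := by
  rw [T.cpa_eq W i hy, T.cpa_eq W i hz, add_sub_add_left_eq_sub, ← inner_sub_right,
    sub_sub_sub_cancel_right]

/-- For small `h > 0` the point `z + h • f z` shares a simplex with `z`, so the quotient equals a
pairing with that gradient. The simplex may change with `h`, but the bound holds for each. -/
theorem dini_cpa_le (hdec : ∀ i, ∀ z ∈ T.σ i, inner ℝ (f z) (T.grad W i) ≤ -b * T.cpa W z)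
    {z : E n} (hz : z ∈ interior T.carrier) :
    dini f (T.cpa W) z ≤ ((-b * T.cpa W z : ℝ) : EReal) := by
  have ht : Tendsto (fun h : ℝ => z + h • f z) (𝓝[>] 0) (𝓝 z) := by
    have : Continuous fun h : ℝ => z + h • f z := by fun_prop
    simpa using (this.tendsto 0).mono_left nhdsWithin_le_nhds
  refine limsup_le_of_le (by isBoundedDefault) ?_
  filter_upwards [self_mem_nhdsWithin, ht (mem_interior_iff_mem_nhds.1 hz),
    ht (T.eventually_mem_σ z)] with h hpos hc hσ
  obtain ⟨i, hi⟩ := mem_iUnion.1 hc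
  have hzi := hσ i hi
  rw [EReal.coe_le_coe_iff, T.cpa_sub_cpa W hi hzi, add_sub_cancel_left, inner_smul_right,
    mul_div_cancel_left₀ _ (ne_of_gt hpos), real_inner_comm]
  exact hdec i z hzi

/-- `V` need not be differentiable across faces, so Grönwall is used with right difference
quotients. Each is the slope of `x` paired with the gradient of some simplex containing `x t`; as
there are finitely many, one interval of times serves them all. -/
theorem cpa_solution_le (hdec : ∀ i, ∀ z ∈ T.σ i, inner ℝ (f z) (T.grad W i) ≤ -b * T.cpa W z)
    {t₀ t₁ : ℝ} {x : ℝ → E n} (hx : IsSolutionOn f T.carrier x (Icc t₀ t₁)) :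
    ∀ t ∈ Icc t₀ t₁, T.cpa W (x t) ≤ T.cpa W (x t₀) * Real.exp (-b * (t - t₀)) := by
  obtain ⟨K, hK⟩ := T.exists_lipschitzOnWith_cpa W
  have hxc : ContinuousOn x (Icc t₀ t₁) := fun t ht => (hx t ht).2.continuousWithinAt
  have hgr := le_gronwallBound_of_liminf_deriv_right_le (f := fun t => T.cpa W (x t))
    (f' := fun t => -b * T.cpa W (x t)) (δ := T.cpa W (x t₀)) (K := -b) (ε := 0)
    (a := t₀) (b := t₁) (hK.continuousOn.comp hxc fun t ht => (hx t ht).1) ?_ le_rfl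
    fun t _ => by simp
  · intro t ht
    simpa [gronwallBound_ε0] using hgr t ht
  intro t ht r hr
  have hd : HasDerivWithinAt x (f (x t)) (Ioi t) t :=
    (hx t (Ico_subset_Icc_self ht)).2.mono_of_mem_nhdsWithin
      (nhdsWithin_mono t Ioi_subset_Ici_self (Icc_mem_nhdsGE_of_mem ht))
  have hslope := (hasDerivWithinAt_iff_tendsto_slope' self_notMem_Ioi).1 hd
  have hlt : ∀ᶠ s in 𝓝[>] t, ∀ i, x t ∈ T.σ i → inner ℝ (T.grad W i) (slope x t s) < r := by
    rw [eventually_all]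
    intro i
    by_cases hi : x t ∈ T.σ i
    · have h1 : Tendsto (fun s => inner ℝ (T.grad W i) (slope x t s)) (𝓝[>] t)
          (𝓝 (inner ℝ (T.grad W i) (f (x t)))) := tendsto_const_nhds.inner hslope
      have h2 : inner ℝ (T.grad W i) (f (x t)) < r := by
        rw [real_inner_comm]
        exact (hdec i _ hi).trans_lt hr
      exact (h1.eventually_lt_const h2).mono fun s hs _ => hs
    · exact Eventually.of_forall fun s h => absurd h hi
  have hσ : ∀ᶠ s in 𝓝[>] t, ∀ i, x s ∈ T.σ i → x t ∈ T.σ i :=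
    hd.continuousWithinAt (T.eventually_mem_σ (x t))
  refine Eventually.frequently ?_
  filter_upwards [hlt, hσ, nhdsWithin_mono t Ioi_subset_Ici_self (Icc_mem_nhdsGE_of_mem ht)]
    with s h1 h2 h3
  obtain ⟨i, hi⟩ := mem_iUnion.1 (hx s h3).1
  have := h1 i (h2 i hi)
  rw [slope, inner_smul_right, vsub_eq_sub, ← T.cpa_sub_cpa W hi (h2 i hi)] at this
  exact this

theorem eventually_cpa_lt (T : Triangulation n) (W : T.vertices → ℝ) {z : E n} {r : ℝ}
    (hz : z ∈ interior T.carrier) (hr : T.cpa W z < r) :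
    ∀ᶠ y in 𝓝 z, y ∈ T.carrier ∧ T.cpa W y < r := by
  obtain ⟨K, hK⟩ := T.exists_lipschitzOnWith_cpa W
  have hzi := mem_interior_iff_mem_nhds.1 hz
  filter_upwards [hzi, (hK.continuousOn.continuousAt hzi).eventually_lt_const hr]
    with y hy hy' using ⟨hy, hy'⟩

/-- If a sublevel set stays away from the boundary of the triangulation, solutions starting in it
exist for all future times and remain in it. -/
theorem exists_solution_in_sublevel
    (hdec : ∀ i, ∀ z ∈ T.σ i, inner ℝ (f z) (T.grad W i) ≤ -b * T.cpa W z) (hb : 0 ≤ b)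
    (hnn : ∀ z ∈ T.carrier, 0 ≤ T.cpa W z) (hf : ∃ K, LipschitzOnWith K f T.carrier) {r : ℝ}
    (hr : ∀ z ∈ T.carrier, T.cpa W z < r → z ∈ interior T.carrier) (t₀ : ℝ) {x₀ : E n}
    (hx₀ : x₀ ∈ T.carrier) (hlt : T.cpa W x₀ < r) :
    ∃ x, IsSolutionOn f T.carrier x (Ici t₀) ∧ x t₀ = x₀ ∧
      ∀ t ∈ Ici t₀, T.cpa W (x t) < r := by
  obtain ⟨Kf, hKf⟩ := hf
  -- The equation is solved for a global extension of `f`; the solution is then shown to stay where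
  -- the two fields agree.
  obtain ⟨g, K, L, hg, hgL, hfg⟩ :=
    exists_bounded_lipschitz_extension T.isRegion_carrier.isCompact hKf
  obtain ⟨x, hx0, hx⟩ := exists_forall_hasDerivWithinAt_Ici hg hgL t₀ x₀
  have hxc : ContinuousOn x (Ici t₀) := fun t ht => (hx t ht).continuousWithinAt
  have hcl : IsClosed T.carrier := T.isRegion_carrier.isCompact.isClosed
  let G : Set (E n) := {z ∈ T.carrier | T.cpa W z < r}
  have hGopen : IsOpen G :=
    isOpen_iff_mem_nhds.2 fun z hz => T.eventually_cpa_lt W (hr z hz.1 hz.2) hz.2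
  -- a solution that has been in `G` until time `t` is in `G` at time `t`
  have hstep : ∀ t ∈ Ici t₀, (∀ s ∈ Ico t₀ t, x s ∈ G) → x t ∈ G := by
    intro t ht hs
    rcases eq_or_lt_of_le (mem_Ici.1 ht) with rfl | hlt'
    · rw [hx0]; exact ⟨hx₀, hlt⟩
    have hmem : x t ∈ T.carrier := by
      have hc : Tendsto x (𝓝[<] t) (𝓝 (x t)) :=
        ((hxc t ht).continuousAt (Ici_mem_nhds hlt')).tendsto.mono_left nhdsWithin_le_nhds
      refine hcl.mem_of_tendsto hc ?_
      filter_upwards [Ico_mem_nhdsLT hlt'] with s hs' using (hs s hs').1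
    have hall : ∀ s ∈ Icc t₀ t, x s ∈ T.carrier := fun s hs' =>
      hs'.2.eq_or_lt.elim (fun h => h ▸ hmem) fun h => (hs s ⟨hs'.1, h⟩).1
    have hsol : IsSolutionOn f T.carrier x (Icc t₀ t) := fun s hs' =>
      ⟨hall s hs', by rw [hfg (hall s hs')]; exact (hx s hs'.1).mono Icc_subset_Ici_self⟩
    refine ⟨hmem, ?_⟩
    refine (cpa_solution_le hdec hsol t ⟨ht, le_rfl⟩).trans_lt (lt_of_le_of_lt ?_ hlt)
    rw [hx0]
    refine mul_le_of_le_one_right (hnn _ hx₀) (Real.exp_le_one_iff.2 ?_)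
    have : 0 ≤ t - t₀ := sub_nonneg.2 ht
    nlinarith
  have hG : ∀ t ∈ Ici t₀, x t ∈ G := by
    by_contra! hcon
    -- As `G` is open, a first time outside `G` would be attained, against `hstep`.
    let B : Set ℝ := Ici t₀ ∩ x ⁻¹' Gᶜ
    have hBcl : IsClosed B := hxc.preimage_isClosed_of_isClosed isClosed_Ici hGopen.isClosed_compl
    have hBne : B.Nonempty := hcon
    have hBbdd : BddBelow B := ⟨t₀, fun t ht => ht.1⟩
    have hmem := hBcl.csInf_mem hBne hBbdd
    refine hmem.2 (hstep _ hmem.1 fun s hs => ?_)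
    by_contra hsG
    exact (csInf_le hBbdd ⟨hs.1, hsG⟩).not_gt hs.2
  exact ⟨x, fun t ht => ⟨(hG t ht).1, by rw [hfg (hG t ht).1]; exact hx t ht⟩, hx0,
    fun t ht => (hG t ht).2⟩

/-- An interpolation that decreases along the vector field has no local maximum with a positive
value. -/
theorem cpa_lt_of_mem_interior
    (hdec : ∀ i, ∀ z ∈ T.σ i, inner ℝ (f z) (T.grad W i) ≤ -b * T.cpa W z) (hb : 0 < b) {r : ℝ}
    (hr : 0 < r) {A : Set (E n)} (hA : ∀ z ∈ A, z ∈ T.carrier ∧ T.cpa W z ≤ r) {z : E n}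
    (hz : z ∈ interior A) : T.cpa W z < r := by
  by_contra! hge
  -- A small step backwards along the field stays in `A` but raises `V` above its value at `z`,
  -- hence above `r`.
  have ht : Tendsto (fun h : ℝ => z - h • f z) (𝓝[>] 0) (𝓝 z) := by
    have : Continuous fun h : ℝ => z - h • f z := by fun_prop
    simpa using (this.tendsto 0).mono_left nhdsWithin_le_nhds
  have hev : ∀ᶠ h : ℝ in 𝓝[>] 0, False := by
    filter_upwards [self_mem_nhdsWithin, ht (mem_interior_iff_mem_nhds.1 hz),
      ht (T.eventually_mem_σ z)] with h hpos hc hσ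
    obtain ⟨i, hi⟩ := mem_iUnion.1 (hA _ hc).1
    have hzi := hσ i hi
    have h1 := T.cpa_sub_cpa W hzi hi
    rw [sub_sub_cancel, inner_smul_right, real_inner_comm] at h1
    have h2 := hdec i z hzi
    have h3 := (hA _ hc).2
    have h4 : 0 < b * T.cpa W z := mul_pos hb (hr.trans_le hge)
    have h5 : h * inner ℝ (f z) (T.grad W i) < 0 := mul_neg_of_pos_of_neg hpos (by linarith)
    linarith
  exact hev.exists.elim fun _ h => h

/-- Since `c‖z‖ ≤ V z ≤ (K + 1)‖z‖`, the decay of `V` passes to the norm with the same rate and `M =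
(K + 1) / c`. -/
theorem locallyExpStable (hf0 : f 0 = 0)
    (hdec : ∀ i, ∀ z ∈ T.σ i, inner ℝ (f z) (T.grad W i) ≤ -b * T.cpa W z) (hb : 0 < b)
    (hf : ∃ K, LipschitzOnWith K f T.carrier) (hW0 : W T.zeroVert = 0)
    (hpos : ∀ v : T.vertices, (v : E n) ≠ 0 → 0 < W v) :
    LocallyExpStable f T.carrier := by
  obtain ⟨c, hc, hcle⟩ := T.exists_mul_norm_le_cpa hW0 hpos
  obtain ⟨K, hK⟩ := T.exists_lipschitzOnWith_cpa W
  have hnn : ∀ z ∈ T.carrier, 0 ≤ T.cpa W z := fun z hz =>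
    (mul_nonneg hc.le (norm_nonneg z)).trans (hcle z hz)
  have hKle : ∀ z ∈ T.carrier, T.cpa W z ≤ (K + 1) * ‖z‖ := fun z hz => by
    have := hK.dist_le_mul z hz 0 T.zero_mem_carrier
    rw [T.cpa_zero hW0, dist_zero_right, dist_zero_right, Real.norm_of_nonneg (hnn z hz)] at this
    linarith [norm_nonneg z]
  obtain ⟨ρ, hρ, hball⟩ := Metric.isOpen_iff.1 isOpen_interior 0
    T.isRegion_carrier.zero_mem_interior
  have hK1 : (0 : ℝ) < K + 1 := by positivity
  have hr : ∀ z ∈ T.carrier, T.cpa W z < c * ρ → z ∈ interior T.carrier := fun z hz hlt =>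
    hball (mem_ball_zero_iff.2 (lt_of_mul_lt_mul_left ((hcle z hz).trans_lt hlt) hc.le))
  -- The radius `ρ` keeps `x₀` inside the triangulation; the other one makes `V x₀ < c * ρ`, a level
  -- below which points lie in the ball of radius `ρ`.
  refine ⟨hf0, min ρ (c * ρ / (K + 1)), by positivity, (K + 1) / c, by positivity, b, hb,
    fun t₀ x₀ hx₀ => ?_⟩
  have hx₀c : x₀ ∈ T.carrier :=
    interior_subset (hball (mem_ball_zero_iff.2 (hx₀.trans_le (min_le_left _ _))))
  refine ⟨?_, fun t₁ x hx hx0 t ht => ?_⟩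
  · have hlt : T.cpa W x₀ < c * ρ := by
      refine (hKle x₀ hx₀c).trans_lt ?_
      rw [← lt_div_iff₀' hK1]
      exact hx₀.trans_le (min_le_right _ _)
    obtain ⟨x, h1, h2, -⟩ := exists_solution_in_sublevel hdec hb.le hnn hf hr t₀ hx₀c hlt
    exact ⟨x, h1, h2⟩
  · have h1 := cpa_solution_le hdec hx t ht
    have h2 := hcle _ (hx t ht).1
    have h3 := mul_le_mul_of_nonneg_right (hKle x₀ hx₀c) (Real.exp_pos (-b * (t - t₀))).le
    rw [hx0] at h1
    rw [div_mul_eq_mul_div, div_mul_eq_mul_div, le_div_iff₀ hc]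
    linarith

end Triangulation

theorem norm_le_of_mul_rpow_le {s r a b₁ b t : ℝ} (hs : 0 ≤ s) (hr : 0 < r) (ha : 0 < a)
    (hb₁ : 0 < b₁) (h : b₁ * s ^ a ≤ r * Real.exp (-b * t)) :
    s ≤ (r / b₁) ^ (1 / a) * Real.exp (-(b / a) * t) := by
  have hq : 0 < r / b₁ := div_pos hr hb₁
  rw [← Real.rpow_le_rpow_iff hs (by positivity) ha,
    Real.mul_rpow (by positivity) (Real.exp_pos _).le, ← Real.rpow_mul hq.le,
    one_div_mul_cancel ha.ne', Real.rpow_one, ← Real.exp_mul,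
    show -(b / a) * t * a = -b * t by field_simp, div_mul_eq_mul_div, le_div_iff₀ hb₁]
  linarith

end CPAControl
end

/-! ### The main theorem. -/

theorem theorem3 {n m : ℕ} {Λ : Type*}
    (X : Set (E n)) (hX : IsRegion X) (U : Set (E m)) (hU : IsRegion U)
    (g : E n → E m → E n) (hg : g 0 0 = 0)
    (T : Triangulation n) (hTX : T.carrier ⊆ X)
    -- the class of controllers `u(·, λ)`
    (u : E n → Λ → E m)
    (hu_zero : ∀ lam, u 0 lam = 0)
    (hu_lip : ∀ lam, ∃ K, LipschitzOnWith K (fun z => u z lam) T.carrier)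
    (hu_C2 : ∀ lam, T.PiecewiseC2 (fun z => u z lam))
    (hg_lip : ∀ lam, AdmissibleAtVertices T U u lam →
      ∃ K, LipschitzOnWith K (closedLoop g u lam) T.carrier)
    (hg_C2 : ∀ lam, AdmissibleAtVertices T U u lam → T.PiecewiseC2 (closedLoop g u lam))
    (hu_adm : ∀ lam, AdmissibleAtVertices T U u lam → ∀ z ∈ T.carrier, u z lam ∈ U)
    (hu_ex : ∃ lam, AdmissibleAtVertices T U u lam)
    -- the cost function
    (J : Unknowns T Λ → ℝ) :
    -- bounds `β` of the second derivatives exist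
    (∃ β : Λ → Fin T.num → ℝ, ∀ lam, AdmissibleAtVertices T U u lam →
      T.BoundsSecondDerivs (closedLoop g u lam) (β lam)) ∧
    ∀ β : Λ → Fin T.num → ℝ,
      (∀ lam, AdmissibleAtVertices T U u lam →
        T.BoundsSecondDerivs (closedLoop g u lam) (β lam)) →
      -- the program is feasible
      (∃ y, Feasible T U g u β y) ∧
      -- every optimum with a positive decay rate stabilizes
      ∀ y, Feasible T U g u β y → IsMinOn J {y' | Feasible T U g u β y'} y → 0 < y.b₂ →
        (∀ z ∈ T.carrier, u z y.lam ∈ U) ∧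
        (∃ a' b₁', IsLyapunov (closedLoop g u y.lam) T.carrier (T.cpa y.V) a' b₁' y.b₂) ∧
        (1 ≤ y.a →
          IsLyapunov (closedLoop g u y.lam) T.carrier (T.cpa y.V) y.a y.b₁ y.b₂) ∧
        LocallyExpStable (closedLoop g u y.lam) T.carrier ∧
        ∀ r > 0, ∀ A : Set (E n), A = {z ∈ T.carrier | T.cpa y.V z ∈ Icc 0 r} → IsRegion A →
          -- the bound, along every solution and as long as it is defined
          (1 ≤ y.a → ∀ t₀ t₁ x, IsSolutionOn (closedLoop g u y.lam) T.carrier x (Icc t₀ t₁) →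
            x t₀ ∈ interior A → ∀ t ∈ Icc t₀ t₁,
              ‖x t‖ ≤ (r / y.b₁) ^ (1 / y.a) * Real.exp (-(y.b₂ / y.a) * (t - t₀))) ∧
          -- solutions exist for all future times and stay in `A`
          ((∀ z ∈ frontier T.carrier, r ≤ T.cpa y.V z) →
            ∀ t₀ : ℝ, ∀ x₀ ∈ interior A,
              ∃ x, IsSolutionOn (closedLoop g u y.lam) T.carrier x (Ici t₀) ∧ x t₀ = x₀ ∧
                ∀ t ∈ Ici t₀, x t ∈ interior A) := by
  refine ⟨?_, fun β hβ => ⟨exists_feasible hg hu_zero hu_ex β, fun y hy _ hb₂ => ?_⟩⟩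
  · classical
    have : ∀ lam, ∃ β, AdmissibleAtVertices T U u lam →
        T.BoundsSecondDerivs (closedLoop g u lam) β := fun lam => by
      by_cases h : AdmissibleAtVertices T U u lam
      · obtain ⟨β, hβ⟩ := T.exists_boundsSecondDerivs (hg_C2 lam h)
        exact ⟨β, fun _ => hβ⟩
      · exact ⟨0, fun h' => absurd h' h⟩
    choose β hβ using this
    exact ⟨β, hβ⟩
  have hadm := hy.input
  have hlip := hg_lip _ hadm
  have hf0 : closedLoop g u y.lam 0 = 0 := by simp [closedLoop, hu_zero, hg]
  have hdec : ∀ i, ∀ z ∈ T.σ i,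
      inner ℝ (closedLoop g u y.lam z) (T.grad y.V i) ≤ -y.b₂ * T.cpa y.V z := fun i z hz =>
    hy.inner_grad_le (hg_C2 _ hadm) (hβ _ hadm) i hz
  have hpos : ∀ v : T.vertices, (v : E n) ≠ 0 → 0 < y.V v := fun v hv =>
    (mul_pos hy.b₁_pos (Real.rpow_pos_of_pos (norm_pos_iff.2 hv) _)).trans_le (hy.lower v hv)
  obtain ⟨c, hc, hcle⟩ := T.exists_mul_norm_le_cpa hy.V_zero hpos
  have hnn : ∀ z ∈ T.carrier, 0 ≤ T.cpa y.V z := fun z hz =>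
    (mul_nonneg hc.le (norm_nonneg z)).trans (hcle z hz)
  have hlyap : ∀ a b₁ : ℝ, 0 < a → 0 < b₁ → (∀ z ∈ T.carrier, b₁ * ‖z‖ ^ a ≤ T.cpa y.V z) →
      IsLyapunov (closedLoop g u y.lam) T.carrier (T.cpa y.V) a b₁ y.b₂ := fun a b₁ ha hb₁ h =>
    ⟨ha, hb₁, hb₂, T.exists_lipschitzOnWith_cpa y.V, T.cpa_zero hy.V_zero, h,
      fun z hz => Triangulation.dini_cpa_le hdec hz.1⟩
  have hlow : 1 ≤ y.a → ∀ z ∈ T.carrier, y.b₁ * ‖z‖ ^ y.a ≤ T.cpa y.V z := fun ha z hz =>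
    T.mul_norm_rpow_le_cpa hy.V_zero ha hy.b₁_pos hy.lower hz
  -- The linear lower bound holds whatever `y.a` is, so the exponent `1` always serves.
  refine ⟨hu_adm _ hadm, ⟨1, c, hlyap 1 c one_pos hc (by simpa using hcle)⟩,
    fun ha => hlyap _ _ hy.a_pos hy.b₁_pos (hlow ha),
    Triangulation.locallyExpStable hf0 hdec hb₂ hlip hy.V_zero hpos, fun r hr A hA _ => ⟨?_, ?_⟩⟩
  · intro ha t₀ t₁ x hx hx₀ t ht
    have hV : T.cpa y.V (x t₀) ≤ r := by
      have := interior_subset hx₀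
      rw [hA] at this
      exact this.2.2
    refine norm_le_of_mul_rpow_le (norm_nonneg _) hr hy.a_pos hy.b₁_pos ?_
    exact (hlow ha _ (hx t ht).1).trans ((Triangulation.cpa_solution_le hdec hx t ht).trans
      (mul_le_mul_of_nonneg_right hV (Real.exp_pos _).le))
  · intro hfr t₀ x₀ hx₀
    have hint : ∀ z ∈ T.carrier, T.cpa y.V z < r → z ∈ interior T.carrier := fun z hz hlt => by
      by_contra h
      exact (hfr z ⟨subset_closure hz, h⟩).not_gt hlt
    have hlt : T.cpa y.V x₀ < r :=
      Triangulation.cpa_lt_of_mem_interior hdec hb₂ hr (A := A) (fun z hz => by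
        rw [hA] at hz
        exact ⟨hz.1, hz.2.2⟩) hx₀
    have hx₀c : x₀ ∈ T.carrier := by
      have := interior_subset hx₀
      rw [hA] at this
      exact this.1
    obtain ⟨x, h1, h2, h3⟩ :=
      Triangulation.exists_solution_in_sublevel hdec hb₂.le hnn hlip hint t₀ hx₀c hlt
    -- The strict sublevel set is open and, as `V` is nonnegative, contained in `A`.
    refine ⟨x, h1, h2, fun t ht => mem_interior_iff_mem_nhds.2 ?_⟩
    filter_upwards [T.eventually_cpa_lt y.V (hint _ (h1 t ht).1 (h3 t ht)) (h3 t ht)] with z hz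
    rw [hA]
    exact ⟨hz.1, hnn z hz.1, hz.2.le⟩
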